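/- Let $\lambda>-1$ and $t\in\mathbb{R}$ be fixed, and let $\omega(x;t,\lambda)=|x|^{2\lambda+1}\exp(-x^6+tx^2)$, $x\in\mathbb{R}$, be the generalised sextic Freud weight. The monic polynomials $P_n$ of degree $n$ ($n\ge 0$) that are orthogonal on $\mathbb{R}$ with respect to $\omega(\cdot\,;t,\lambda)$ exist and satisfy a three-term recurrence relation $$P_{n+1}(x)=xP_n(x)-\beta_n(t;\lambda)P_{n-1}(x),\qquad n\ge 0,\qquad P_{-1}=0,\quad P_0=1 .$$ The recurrence coefficients have, with $\kappa=\sqrt[3]{60}$, the following asymptotic expansions as $n\to\infty$, where the implied constants may depend on $t$ and $\lambda$: if $n$ is even, $$\beta_n(t;\lambda)=\frac{n^{1/3}}{\kappa}+\frac{t\kappa}{90\,n^{1/3}}-\frac{(2\lambda+1)\kappa^2}{90\,n^{2/3}}-\frac{4t(2\lambda+1)\kappa}{135\,n^{4/3}}-\frac{[t^3-135(7\lambda^2+7\lambda+2)]\kappa^2}{36450\,n^{5/3}}+\mathcal{O}(n^{-2}),$$ and if $n$ is odd, $$\beta_n(t;\lambda)=\frac{n^{1/3}}{\kappa}+\frac{t\kappa}{90\,n^{1/3}}+\frac{(2\lambda+1)\kappa^2}{60\,n^{2/3}}+\frac{7t(2\lambda+1)\kappa}{270\,n^{4/3}}-\frac{[2t^3+135(6\lambda^2+6\lambda+1)]\kappa^2}{72900\,n^{5/3}}+\mathcal{O}(n^{-2}).$$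 -/

import Mathlib

open Filter Asymptotics MeasureTheory Polynomial

noncomputable section

/-- The generalised sextic Freud weight `|x|^(2λ+1) exp(-x^6 + t x^2)` on the real line. -/
def sexticFreudWeight (t lam x : ℝ) : ℝ :=
  |x| ^ (2 * lam + 1) * Real.exp (-x ^ 6 + t * x ^ 2)

/-- `P n`, `n = 0, 1, 2, …`, is the sequence of monic orthogonal polynomials for the weight `w`
on the real line: every polynomial is integrable against `w`, `P n` is monic of degree `n`,
and `∫ P m * P n * w` is zero for `m ≠ n` and positive for `m = n`. -/
structure IsMonicOrthogonal (w : ℝ → ℝ) (P : ℕ → ℝ[X]) : Prop where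
  integrable : ∀ p : ℝ[X], Integrable (fun x : ℝ => p.eval x * w x)
  monic : ∀ n, (P n).Monic
  natDegree_eq : ∀ n, (P n).natDegree = n
  orthogonal : ∀ m n, m ≠ n → ∫ x : ℝ, (P m).eval x * (P n).eval x * w x = 0
  norm_pos : ∀ n, 0 < ∫ x : ℝ, (P n).eval x * (P n).eval x * w x

/-- `β` is the sequence of recurrence coefficients of `P`: with `P (-1) = 0` and `P 0 = 1`, the
three-term recurrence `P (n+1) = x * P n - β n * P (n-1)` holds for all `n ≥ 0`. The case `n = 0`
reads `P 1 = x`; the number `β 0` multiplies `P (-1) = 0` and stays arbitrary. -/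
structure IsRecurrenceCoeff (P : ℕ → ℝ[X]) (β : ℕ → ℝ) : Prop where
  zero : P 0 = 1
  one : P 1 = X
  step : ∀ n, P (n + 2) = X * P (n + 1) - C (β (n + 1)) * P n

/-- The constant `κ = 60^(1/3)`. -/
def kappa : ℝ := (60 : ℝ) ^ (1 / 3 : ℝ)

/-- The expansion, up to and including the power `n^(-5/3)`, for even indices. -/
def evenExpansion (t lam n : ℝ) : ℝ :=
  n ^ (1 / 3 : ℝ) / kappa
    + t * kappa / (90 * n ^ (1 / 3 : ℝ))
    - (2 * lam + 1) * kappa ^ 2 / (90 * n ^ (2 / 3 : ℝ))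
    - 4 * t * (2 * lam + 1) * kappa / (135 * n ^ (4 / 3 : ℝ))
    - (t ^ 3 - 135 * (7 * lam ^ 2 + 7 * lam + 2)) * kappa ^ 2 / (36450 * n ^ (5 / 3 : ℝ))

/-- The expansion, up to and including the power `n^(-5/3)`, for odd indices. -/
def oddExpansion (t lam n : ℝ) : ℝ :=
  n ^ (1 / 3 : ℝ) / kappa
    + t * kappa / (90 * n ^ (1 / 3 : ℝ))
    + (2 * lam + 1) * kappa ^ 2 / (60 * n ^ (2 / 3 : ℝ))
    + 7 * t * (2 * lam + 1) * kappa / (270 * n ^ (4 / 3 : ℝ))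
    - (2 * t ^ 3 + 135 * (6 * lam ^ 2 + 6 * lam + 1)) * kappa ^ 2 / (72900 * n ^ (5 / 3 : ℝ))

end

open Topology


/-! ### The weight and its moment functional -/

/-! For a polynomial r the function X r w vanishes at 0, because 2λ+2 > 0, and at ±∞, so its
derivative integrates to 0. Choosing X r = P_n P_{n-1} turns this into a nonlinear difference
equation, the string equation F(β_{n-2}, …, β_{n+2}) - 2tβ_n = n + (2λ+1)[n odd], where F is
`freudCubic`, a cubic form with nonnegative coefficients and F(x,x,x,x,x) = 60x³. The asymptotics
use only this equation (for n ≥ 4) and β_n > 0 for n ≥ 1.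

Put h = n^(-1/3). The scaled sequence β_n h is bounded, so its cluster points form a nonempty
compact set with largest element A and smallest element a. The limiting equation F = 1 holds with
centre A and with centre a, all neighbours lying in [a, A]; monotonicity of F then forces A = a
(`freudCubic_extremes`). Hence β_n h tends to the positive X with 60X³ = 1, that is X = 1/κ.

Let b_n be the claimed expansion. In the scaled equation it leaves a residual O(h⁷)
(`scaledResidual_even_isBigO`, `scaledResidual_odd_isBigO`). Subtracting the two equations and
dividing by h, β - b satisfies a linear five-term relation with error O(h⁶) = O(n⁻²), whose
coefficients tend to X²·(6, 36, 96, 36, 6). Since 96 > 6 + 36 + 36 + 6, the diagonal dominates, and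
`exists_bound_of_contracting_step` yields β - b = O(n⁻²).

Existence is separate: the weight is even and its moment functional is positive definite, so the
polynomials can be built from the recurrence. -/

theorem sexticFreudWeight_neg (t lam x : ℝ) :
    sexticFreudWeight t lam (-x) = sexticFreudWeight t lam x := by
  simp [sexticFreudWeight, Even.neg_pow (show Even 6 by decide)]

theorem sexticFreudWeight_of_pos (t lam : ℝ) {x : ℝ} (hx : 0 < x) :
    sexticFreudWeight t lam x = x ^ (2 * lam + 1) * Real.exp (-x ^ 6 + t * x ^ 2) := by
  rw [sexticFreudWeight, abs_of_pos hx]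

theorem measurable_sexticFreudWeight (t lam : ℝ) : Measurable (sexticFreudWeight t lam) := by
  unfold sexticFreudWeight
  fun_prop

/-- Supplies a Gaussian majorant: for x² ≥ |t| + 1 the sextic term absorbs (|t| + 1)x², and below
that threshold the constant does. -/
theorem neg_pow_six_add_le (t x : ℝ) :
    -x ^ 6 + t * x ^ 2 ≤ (|t| + 2) ^ 2 - x ^ 2 := by
  set y := x ^ 2 with hy
  have hy0 : 0 ≤ y := sq_nonneg x
  have h6 : x ^ 6 = y ^ 3 := by rw [hy]; ring
  rw [h6]
  have ht : t * y ≤ |t| * y := mul_le_mul_of_nonneg_right (le_abs_self t) hy0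
  have ht0 := abs_nonneg t
  rcases le_total y (|t| + 1) with h | h
  · have : 0 ≤ y ^ 3 := by positivity
    nlinarith [mul_le_mul_of_nonneg_left h ht0]
  · have : (|t| + 1) * y ≤ y ^ 3 := by
      have : |t| + 1 ≤ y ^ 2 := by nlinarith
      nlinarith
    nlinarith

/-- The condition λ > -1 makes the exponent k + 2λ + 1 exceed -1, which gives integrability at the
origin; the Gaussian majorant handles infinity. -/
theorem integrableOn_Ioi_monomial_mul_weight (t : ℝ) {lam : ℝ} (hlam : -1 < lam) (k : ℕ) :
    IntegrableOn (fun x : ℝ => x ^ k * sexticFreudWeight t lam x) (Set.Ioi 0) := by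
  have hs : -1 < (k : ℝ) + (2 * lam + 1) := by
    have : (0 : ℝ) ≤ k := k.cast_nonneg
    linarith
  have h := (integrableOn_rpow_mul_exp_neg_mul_rpow (p := 2) hs two_pos one_pos).const_mul
    (Real.exp ((|t| + 2) ^ 2))
  refine Integrable.mono' h ?_ ?_
  · exact ((measurable_id.pow_const k).mul
      (measurable_sexticFreudWeight t lam)).aestronglyMeasurable
  · refine (ae_restrict_iff' measurableSet_Ioi).2 (Eventually.of_forall fun x hx => ?_)
    have hx : 0 < x := hx
    rw [sexticFreudWeight_of_pos t lam hx, ← mul_assoc, ← Real.rpow_natCast, ← Real.rpow_add hx,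
      Real.norm_of_nonneg (by positivity), mul_left_comm, ← Real.exp_add]
    refine mul_le_mul_of_nonneg_left (Real.exp_le_exp.2 ?_) (by positivity)
    have := neg_pow_six_add_le t x
    norm_num
    linarith

theorem integrableOn_Ioi_eval_mul_weight (t : ℝ) {lam : ℝ} (hlam : -1 < lam) (p : ℝ[X]) :
    IntegrableOn (fun x : ℝ => p.eval x * sexticFreudWeight t lam x) (Set.Ioi 0) := by
  induction p using Polynomial.induction_on' with
  | add p q hp hq =>
    simp only [eval_add, add_mul]
    exact hp.add hq
  | monomial k a =>
    simp only [eval_monomial, mul_assoc]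
    exact (integrableOn_Ioi_monomial_mul_weight t hlam k).const_mul a

theorem integrable_of_integrableOn_Ioi {f : ℝ → ℝ} (h₁ : IntegrableOn f (Set.Ioi 0))
    (h₂ : IntegrableOn (fun x => f (-x)) (Set.Ioi 0)) : Integrable f := by
  have h₃ : IntegrableOn f (Set.Iic 0) := by
    rw [← neg_zero, ← integrableOn_Ici_iff_integrableOn_Ioi] at *
    simpa using h₂.comp_neg
  simpa using h₃.union h₁

theorem integral_eq_integral_Ioi_add {f : ℝ → ℝ} (hf : Integrable f) :
    ∫ x, f x = (∫ x in Set.Ioi 0, f x) + ∫ x in Set.Ioi 0, f (-x) := by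
  rw [integral_comp_neg_Ioi, neg_zero, add_comm,
    intervalIntegral.integral_Iic_add_Ioi hf.integrableOn hf.integrableOn]

theorem integrable_eval_mul_weight (t : ℝ) {lam : ℝ} (hlam : -1 < lam) (p : ℝ[X]) :
    Integrable (fun x : ℝ => p.eval x * sexticFreudWeight t lam x) := by
  refine integrable_of_integrableOn_Ioi (integrableOn_Ioi_eval_mul_weight t hlam p) ?_
  simpa [sexticFreudWeight_neg] using integrableOn_Ioi_eval_mul_weight t hlam (p.comp (-X))

/-- The moment functional `p ↦ ∫ p w` of a weight all of whose moments are finite. -/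
noncomputable def momentFunctional (w : ℝ → ℝ)
    (hw : ∀ p : ℝ[X], Integrable (fun x : ℝ => p.eval x * w x)) : ℝ[X] →ₗ[ℝ] ℝ where
  toFun p := ∫ x, p.eval x * w x
  map_add' p q := by
    simp only [eval_add, add_mul]
    exact integral_add (hw p) (hw q)
  map_smul' a p := by
    simp only [eval_smul, smul_eq_mul, mul_assoc, RingHom.id_apply]
    exact integral_const_mul a _

theorem momentFunctional_apply {w : ℝ → ℝ}
    (hw : ∀ p : ℝ[X], Integrable (fun x : ℝ => p.eval x * w x)) (p : ℝ[X]) :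
    momentFunctional w hw p = ∫ x, p.eval x * w x := rfl

theorem momentFunctional_comp_neg {w : ℝ → ℝ}
    (hw : ∀ p : ℝ[X], Integrable (fun x : ℝ => p.eval x * w x)) (heven : ∀ x, w (-x) = w x)
    (p : ℝ[X]) : momentFunctional w hw (p.comp (-X)) = momentFunctional w hw p := by
  simp only [momentFunctional_apply]
  rw [← integral_neg_eq_self]
  simp [heven]

theorem momentFunctional_mul_self_pos {w : ℝ → ℝ}
    (hw : ∀ p : ℝ[X], Integrable (fun x : ℝ => p.eval x * w x)) (hpos : ∀ x, x ≠ 0 → 0 < w x)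
    (h0 : 0 ≤ w 0) {p : ℝ[X]} (hp : p ≠ 0) : 0 < momentFunctional w hw (p * p) := by
  have hnn : ∀ x, 0 ≤ w x := fun x => by
    by_cases hx : x = 0
    · rwa [hx]
    · exact (hpos x hx).le
  rw [momentFunctional_apply, integral_pos_iff_support_of_nonneg _ (hw _)]
  · have hsub : ((p * X).roots.toFinset : Set ℝ)ᶜ ⊆
        Function.support fun x => (p * p).eval x * w x := by
      intro x hx
      have hpX : p * X ≠ 0 := mul_ne_zero hp X_ne_zero
      simp only [Set.mem_compl_iff, Finset.mem_coe, Multiset.mem_toFinset, mem_roots hpX,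
        IsRoot.def, eval_mul, eval_X, mul_eq_zero, not_or] at hx
      simp [hx.1, (hpos x hx.2).ne']
    refine lt_of_lt_of_le ?_ (measure_mono hsub)
    have h0 : volume ((p * X).roots.toFinset : Set ℝ) = 0 := (Finset.finite_toSet _).measure_zero _
    rw [measure_compl (Finset.measurableSet _) (by simp [h0]), h0]
    simp
  · intro x
    simp only [eval_mul, Pi.zero_apply]
    exact mul_nonneg (mul_self_nonneg _) (hnn x)

/-- The polynomial `q` for which `(X r w)' = q w`, where `w` is the sextic Freud weight. -/
noncomputable def pearsonOp (t lam : ℝ) (r : ℝ[X]) : ℝ[X] :=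
  derivative (X * r) + C (2 * lam + 1) * r - X * r * (C 6 * X ^ 5 - C (2 * t) * X)

theorem pearsonOp_comp_neg (t lam : ℝ) (r : ℝ[X]) :
    (pearsonOp t lam r).comp (-X) = pearsonOp t lam (r.comp (-X)) := by
  simp only [pearsonOp, derivative_mul, derivative_X, derivative_comp, derivative_neg, add_comp,
    sub_comp, mul_comp, pow_comp, X_comp, C_comp, one_mul]
  ring

theorem hasDerivAt_eval_mul_weight (t lam : ℝ) (r : ℝ[X]) {x : ℝ} (hx : 0 < x) :
    HasDerivAt (fun x => (X * r).eval x * sexticFreudWeight t lam x)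
      ((pearsonOp t lam r).eval x * sexticFreudWeight t lam x) x := by
  have h₁ : HasDerivAt (fun x : ℝ => x ^ (2 * lam + 1)) _ x :=
    Real.hasDerivAt_rpow_const (Or.inl hx.ne')
  have h₂ : HasDerivAt (fun x : ℝ => Real.exp (-x ^ 6 + t * x ^ 2))
      (Real.exp (-x ^ 6 + t * x ^ 2) * (-(6 * x ^ 5) + t * (2 * x))) x := by
    refine HasDerivAt.exp ?_
    refine (((hasDerivAt_pow 6 x).neg).add ((hasDerivAt_pow 2 x).const_mul t)).congr_deriv ?_
    norm_num
  have h := ((X * r).hasDerivAt x).mul (h₁.mul h₂)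
  refine (h.congr_of_eventuallyEq ?_).congr_deriv ?_
  · filter_upwards [lt_mem_nhds hx] with y hy
    simp [sexticFreudWeight_of_pos t lam hy]
  · rw [sexticFreudWeight_of_pos t lam hx, Real.rpow_sub_one hx.ne']
    simp only [pearsonOp, eval_add, eval_sub, eval_mul, eval_pow, eval_X, eval_C, Pi.mul_apply]
    field_simp
    ring

/-- The extra factor X kills the boundary term at 0, leaving x^(2λ+2) with positive exponent. At
infinity the limit is 0 because the function and its derivative are both integrable. -/
theorem integral_Ioi_pearsonOp (t : ℝ) {lam : ℝ} (hlam : -1 < lam) (r : ℝ[X]) :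
    ∫ x in Set.Ioi 0, (pearsonOp t lam r).eval x * sexticFreudWeight t lam x = 0 := by
  have hF' := integrableOn_Ioi_eval_mul_weight t hlam (pearsonOp t lam r)
  have hd : ∀ x ∈ Set.Ioi (0 : ℝ), HasDerivAt _ _ x :=
    fun x hx => hasDerivAt_eval_mul_weight t lam r hx
  have hlim := tendsto_zero_of_hasDerivAt_of_integrableOn_Ioi hd hF'
    (integrableOn_Ioi_eval_mul_weight t hlam (X * r))
  have hcont : ContinuousWithinAt (fun x => (X * r).eval x * sexticFreudWeight t lam x)
      (Set.Ici 0) 0 := by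
    have hne : 2 * lam + 2 ≠ 0 := by linarith
    have h : ContinuousWithinAt (fun x : ℝ => x ^ (2 * lam + 2) *
        (r.eval x * Real.exp (-x ^ 6 + t * x ^ 2))) (Set.Ici 0) 0 := by
      refine ((Real.continuousAt_rpow_const 0 _ (Or.inr (by linarith))).mul ?_).continuousWithinAt
      exact (r.continuous.mul (by fun_prop)).continuousAt
    refine h.congr (fun x hx => ?_) ?_
    · rcases eq_or_lt_of_le (show 0 ≤ x from hx) with rfl | hx
      · simp [Real.zero_rpow hne]
      · rw [sexticFreudWeight_of_pos t lam hx, show 2 * lam + 2 = (2 * lam + 1) + 1 by ring,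
          Real.rpow_add_one hx.ne' (2 * lam + 1)]
        simp only [eval_mul, eval_X]
        ring
    · simp [Real.zero_rpow hne]
  rw [integral_Ioi_of_hasDerivAt_of_tendsto hcont hd hF' hlim]
  simp

theorem integral_pearsonOp (t : ℝ) {lam : ℝ} (hlam : -1 < lam) (r : ℝ[X]) :
    ∫ x, (pearsonOp t lam r).eval x * sexticFreudWeight t lam x = 0 := by
  rw [integral_eq_integral_Ioi_add (integrable_eval_mul_weight t hlam _),
    integral_Ioi_pearsonOp t hlam r]
  have h := integral_Ioi_pearsonOp t hlam (r.comp (-X))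
  rw [← pearsonOp_comp_neg] at h
  simpa [sexticFreudWeight_neg] using h

/-! ### Monic orthogonal polynomials of an even positive functional -/

/-- The pairs `(P n, P (n + 1))` of consecutive monic orthogonal polynomials of an even functional. -/
noncomputable def orthogonalPair (L : ℝ[X] →ₗ[ℝ] ℝ) : ℕ → ℝ[X] × ℝ[X]
  | 0 => (1, X)
  | n + 1 =>
    let q := orthogonalPair L n
    (q.2, X * q.2 - C (L (q.2 * q.2) / L (q.1 * q.1)) * q.1)

/-- The monic orthogonal polynomials of an even functional, built by their recurrence. -/
noncomputable def orthogonalPoly (L : ℝ[X] →ₗ[ℝ] ℝ) (n : ℕ) : ℝ[X] := (orthogonalPair L n).1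

/-- The recurrence coefficients `L (P n ^ 2) / L (P (n - 1) ^ 2)`. -/
noncomputable def orthogonalCoeff (L : ℝ[X] →ₗ[ℝ] ℝ) (n : ℕ) : ℝ :=
  L (orthogonalPoly L n * orthogonalPoly L n) /
    L (orthogonalPoly L (n - 1) * orthogonalPoly L (n - 1))

theorem isRecurrenceCoeff_orthogonalPoly (L : ℝ[X] →ₗ[ℝ] ℝ) :
    IsRecurrenceCoeff (orthogonalPoly L) (orthogonalCoeff L) where
  zero := rfl
  one := rfl
  step _ := rfl

theorem IsRecurrenceCoeff.X_mul {P : ℕ → ℝ[X]} {β : ℕ → ℝ} (h : IsRecurrenceCoeff P β) (n : ℕ) :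
    X * P (n + 1) = P (n + 2) + C (β (n + 1)) * P n := by
  rw [h.step]; ring

theorem IsRecurrenceCoeff.monic_natDegree {P : ℕ → ℝ[X]} {β : ℕ → ℝ}
    (h : IsRecurrenceCoeff P β) (n : ℕ) :
    ((P n).Monic ∧ (P n).natDegree = n) ∧ (P (n + 1)).Monic ∧ (P (n + 1)).natDegree = n + 1 := by
  induction n with
  | zero => simp [h.zero, h.one]
  | succ n ih =>
    refine ⟨ih.2, ?_⟩
    obtain ⟨⟨hm, hd⟩, hm', hd'⟩ := ih
    have hXm : (X * P (n + 1)).Monic := monic_X.mul hm'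
    have hXd : (X * P (n + 1)).natDegree = n + 2 := by
      rw [natDegree_X_mul hm'.ne_zero, hd']
    have hlt : (C (β (n + 1)) * P n).natDegree < (X * P (n + 1)).natDegree := by
      refine (natDegree_C_mul_le _ _).trans_lt ?_
      omega
    rw [h.step]
    exact ⟨hXm.sub_of_left (degree_lt_degree hlt),
      by rw [natDegree_sub_eq_left_of_natDegree_lt hlt, hXd]⟩

theorem IsRecurrenceCoeff.comp_neg {P : ℕ → ℝ[X]} {β : ℕ → ℝ}
    (h : IsRecurrenceCoeff P β) (n : ℕ) :
    (P n).comp (-X) = (-1) ^ n * P n ∧ (P (n + 1)).comp (-X) = (-1) ^ (n + 1) * P (n + 1) := by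
  induction n with
  | zero => simp [h.zero, h.one]
  | succ n ih =>
    refine ⟨ih.2, ?_⟩
    rw [h.step, sub_comp, mul_comp, mul_comp, ih.1, ih.2, C_comp, X_comp]
    ring

theorem IsRecurrenceCoeff.map_X_mul_self {P : ℕ → ℝ[X]} {β : ℕ → ℝ}
    (h : IsRecurrenceCoeff P β) {L : ℝ[X] →ₗ[ℝ] ℝ} (hL : ∀ p : ℝ[X], L (p.comp (-X)) = L p)
    (n : ℕ) : L (X * P n * P n) = 0 := by
  have h1 := hL (X * P n * P n)
  have hs : ((-1 : ℝ[X]) ^ n) * (-1) ^ n = 1 := by rw [← mul_pow]; simp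
  rw [mul_comp, mul_comp, X_comp, (h.comp_neg n).1,
    show -X * ((-1) ^ n * P n) * ((-1) ^ n * P n) =
      ((-1 : ℝ[X]) ^ n * (-1) ^ n) * -(X * P n * P n) by ring, hs, one_mul, map_neg] at h1
  linarith

theorem map_C_mul (L : ℝ[X] →ₗ[ℝ] ℝ) (a : ℝ) (p : ℝ[X]) : L (C a * p) = a * L p := by
  rw [C_mul', map_smul, smul_eq_mul]

/-- Two consecutive levels are carried through the induction. In L(P_m P_{n+2}), the case m < n
follows by moving X onto P_m, m = n is the choice of the coefficient, and m = n + 1 vanishes by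
parity. -/
theorem orthogonalPoly_orthogonal {L : ℝ[X] →ₗ[ℝ] ℝ} (hL : ∀ p : ℝ[X], L (p.comp (-X)) = L p)
    (hpos : ∀ p : ℝ[X], p ≠ 0 → 0 < L (p * p)) (n : ℕ) :
    (∀ m < n, L (orthogonalPoly L m * orthogonalPoly L n) = 0) ∧
      ∀ m < n + 1, L (orthogonalPoly L m * orthogonalPoly L (n + 1)) = 0 := by
  have h := isRecurrenceCoeff_orthogonalPoly L
  set P := orthogonalPoly L with hP
  set β := orthogonalCoeff L with hβ
  induction n with
  | zero =>
    refine ⟨by simp, fun m hm => ?_⟩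
    obtain rfl : m = 0 := by omega
    have := h.map_X_mul_self hL 0
    simpa [h.zero, h.one] using this
  | succ n ih =>
    refine ⟨ih.2, fun m hm => ?_⟩
    obtain ⟨ih₁, ih₂⟩ := ih
    have hstep : L (P m * P (n + 1 + 1)) = L (X * P m * P (n + 1)) - β (n + 1) * L (P m * P n) := by
      rw [h.step, ← map_C_mul, ← map_sub]
      congr 1
      ring
    rw [hstep]
    rcases Nat.lt_succ_iff_lt_or_eq.1 hm with hm | rfl
    · have hX : L (X * P m * P (n + 1)) = L (P (m + 1) * P (n + 1)) := by
        rcases m with _ | m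
        · simp [h.zero, h.one]
        · rw [h.X_mul, add_mul, map_add, mul_assoc, map_C_mul, ih₂ m (by omega)]
          ring
      rw [hX]
      rcases Nat.lt_succ_iff_lt_or_eq.1 hm with hm | rfl
      · rw [ih₁ m hm, ih₂ (m + 1) (by omega)]
        ring
      · have : L (P m * P m) ≠ 0 := (hpos _ (h.monic_natDegree m).1.1.ne_zero).ne'
        have hb : β (m + 1) = L (P (m + 1) * P (m + 1)) / L (P m * P m) := rfl
        rw [hb, div_mul_cancel₀ _ this, sub_self]
    · rw [h.map_X_mul_self hL, mul_comm (P (n + 1)), ih₂ n (by omega)]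
      ring

/-! ### Consequences of orthogonality -/

/-- `P` is a sequence of polynomials, monic of degree `n`, orthogonal for the functional `L`, that
satisfies the recurrence with coefficients `β`. -/
structure IsOrthogonalFor (L : ℝ[X] →ₗ[ℝ] ℝ) (P : ℕ → ℝ[X]) (β : ℕ → ℝ) : Prop where
  recurrence : IsRecurrenceCoeff P β
  orthogonal : ∀ m n, m ≠ n → L (P m * P n) = 0
  norm_pos : ∀ n, 0 < L (P n * P n)

namespace IsOrthogonalFor

variable {L : ℝ[X] →ₗ[ℝ] ℝ} {P : ℕ → ℝ[X]} {β : ℕ → ℝ}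

theorem monic (h : IsOrthogonalFor L P β) (n : ℕ) : (P n).Monic :=
  (h.recurrence.monic_natDegree n).1.1

theorem natDegree_eq (h : IsOrthogonalFor L P β) (n : ℕ) : (P n).natDegree = n :=
  (h.recurrence.monic_natDegree n).1.2

theorem map_mul_eq_zero (h : IsOrthogonalFor L P β) {n : ℕ} (k : ℕ) (hk : k ≤ n) (q : ℝ[X])
    (hq : q.degree < k) : L (q * P n) = 0 := by
  induction k generalizing q with
  | zero =>
    have hq : q = 0 := Polynomial.ext fun m => (degree_lt_iff_coeff_zero _ _).1 hq m m.zero_le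
    simp [hq]
  | succ k ih =>
    have hlt : (q - C (q.coeff k) * P k).degree < k := by
      rw [degree_lt_iff_coeff_zero]
      intro m hm
      rcases hm.eq_or_lt with rfl | hm
      · have : (P k).coeff k = 1 := by
          simpa [h.natDegree_eq k] using (h.monic k).coeff_natDegree
        simp [this]
      · have h1 : q.coeff m = 0 := (degree_lt_iff_coeff_zero _ _).1 hq m hm
        have h2 : (P k).coeff m = 0 := coeff_eq_zero_of_natDegree_lt (by rwa [h.natDegree_eq])
        simp [h1, h2]
    have := ih (by omega) _ hlt
    rw [sub_mul, map_sub, mul_assoc, map_C_mul, h.orthogonal k n (by omega)] at this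
    linarith

theorem map_mul_eq (h : IsOrthogonalFor L P β) {n : ℕ} (q : ℝ[X]) (hq : q.natDegree ≤ n) :
    L (q * P n) = q.coeff n * L (P n * P n) := by
  have hlt : (q - C (q.coeff n) * P n).degree < n := by
    rw [degree_lt_iff_coeff_zero]
    intro m hm
    rcases hm.eq_or_lt with rfl | hm
    · have : (P n).coeff n = 1 := by
        simpa [h.natDegree_eq n] using (h.monic n).coeff_natDegree
      simp [this]
    · have h1 : q.coeff m = 0 := coeff_eq_zero_of_natDegree_lt (by omega)
      have h2 : (P n).coeff m = 0 := coeff_eq_zero_of_natDegree_lt (by rwa [h.natDegree_eq])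
      simp [h1, h2]
  have := h.map_mul_eq_zero n le_rfl _ hlt
  rw [sub_mul, map_sub, mul_assoc, map_C_mul] at this
  linarith

/-- Both sides equal L(X P_n P_{n+1}), with the recurrence applied to one factor or the other. -/
theorem norm_succ (h : IsOrthogonalFor L P β) (n : ℕ) :
    L (P (n + 1) * P (n + 1)) = β (n + 1) * L (P n * P n) := by
  have h1 : L (X * P n * P (n + 1)) = L (P (n + 1) * P (n + 1)) := by
    rcases n with _ | n
    · simp [h.recurrence.zero, h.recurrence.one]
    · rw [h.recurrence.X_mul, add_mul, map_add, mul_assoc, map_C_mul,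
        h.orthogonal n _ (by omega)]
      ring
  have h2 : L (X * P n * P (n + 1)) = β (n + 1) * L (P n * P n) := by
    rw [show X * P n * P (n + 1) = P n * (X * P (n + 1)) by ring, h.recurrence.X_mul, mul_add,
      map_add, mul_left_comm, map_C_mul, h.orthogonal n _ (by omega), zero_add]
  rw [← h1, h2]

theorem coeff_pos (h : IsOrthogonalFor L P β) (n : ℕ) : 0 < β (n + 1) := by
  have h1 := h.norm_pos (n + 1)
  rw [h.norm_succ] at h1
  exact pos_of_mul_pos_left h1 (h.norm_pos n).le

theorem X_dvd_of_odd (h : IsOrthogonalFor L P β) (k : ℕ) : X ∣ P (2 * k + 1) := by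
  induction k with
  | zero => simp [h.recurrence.one]
  | succ k ih =>
    rw [show 2 * (k + 1) + 1 = (2 * k + 1) + 2 by ring, h.recurrence.step]
    exact dvd_sub (dvd_mul_right _ _) (dvd_mul_of_dvd_right ih _)

theorem map_derivative_mul (h : IsOrthogonalFor L P β) (n : ℕ) :
    L (derivative (P (n + 1) * P n)) = (n + 1) * L (P n * P n) := by
  have h1 : L (derivative (P (n + 1)) * P n) = (n + 1) * L (P n * P n) := by
    rw [h.map_mul_eq]
    · have hc : (P (n + 1)).coeff (n + 1) = 1 := by
        simpa [h.natDegree_eq (n + 1)] using (h.monic (n + 1)).coeff_natDegree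
      rw [coeff_derivative, hc, one_mul]
    · have := natDegree_derivative_le (P (n + 1))
      rwa [h.natDegree_eq, Nat.add_sub_cancel] at this
  have h2 : L (derivative (P n) * P (n + 1)) = 0 := by
    refine h.map_mul_eq_zero (n + 1) le_rfl _ ?_
    refine (degree_derivative_lt (h.monic n).ne_zero).trans_le ?_
    rw [degree_eq_natDegree (h.monic n).ne_zero, h.natDegree_eq]
    exact_mod_cast n.le_succ
  rw [derivative_mul, map_add, h1, mul_comm (P (n + 1)), h2, add_zero]

/-- The product of consecutive polynomials is `X * r` with a known value of `L r`. -/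
theorem exists_mul_eq_X_mul (h : IsOrthogonalFor L P β) (n : ℕ) :
    ∃ r, P (n + 1) * P n = X * r ∧ L r = (if Odd (n + 1) then 1 else 0) * L (P n * P n) := by
  -- The factor of odd degree is divisible by X. If it is P_{n+1}, its quotient is monic of degree n
  -- and pairs with P_n to the full norm; if it is P_n, the quotient has degree below n + 1 and
  -- pairs to 0. This is the source of the parity term.
  rcases Nat.even_or_odd n with ⟨k, hk⟩ | ⟨k, hk⟩
  · obtain ⟨q, hq⟩ := h.X_dvd_of_odd k
    rw [show 2 * k + 1 = n + 1 by omega] at hq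
    refine ⟨q * P n, by rw [hq, mul_assoc], ?_⟩
    have hq0 : q ≠ 0 := fun h0 => (h.monic (n + 1)).ne_zero (by rw [hq, h0, mul_zero])
    have hdeg : q.natDegree = n := by
      have := h.natDegree_eq (n + 1)
      rw [hq, natDegree_X_mul hq0] at this
      omega
    have hlc : q.coeff n = 1 := by
      have hc : (P (n + 1)).coeff (n + 1) = 1 := by
        simpa [h.natDegree_eq (n + 1)] using (h.monic (n + 1)).coeff_natDegree
      rwa [hq, coeff_X_mul] at hc
    rw [h.map_mul_eq q hdeg.le, hlc, if_pos ⟨k, by omega⟩]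
  · obtain ⟨q, hq⟩ := h.X_dvd_of_odd k
    rw [← hk] at hq
    refine ⟨q * P (n + 1), by rw [hq]; ring, ?_⟩
    have hq0 : q ≠ 0 := fun h0 => (h.monic n).ne_zero (by rw [hq, h0, mul_zero])
    have hdeg : q.natDegree + 1 = n := by
      have := h.natDegree_eq n
      rwa [hq, natDegree_X_mul hq0] at this
    have hodd : ¬ Odd (n + 1) := by rw [Nat.not_odd_iff_even]; exact ⟨k + 1, by omega⟩
    rw [if_neg hodd, zero_mul]
    refine h.map_mul_eq_zero (n + 1) le_rfl _ ?_
    rw [degree_eq_natDegree hq0]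
    exact_mod_cast (by omega)

theorem map_X_mul (h : IsOrthogonalFor L P β) (n : ℕ) :
    L (X * (P (n + 1) * P n)) = β (n + 1) * L (P n * P n) := by
  rw [← mul_assoc, h.recurrence.X_mul, add_mul, map_add, mul_assoc, map_C_mul,
    h.orthogonal (n + 2) n (by omega), zero_add]

/-- Splitting X⁵ as X² on P_{n+4} and X³ on P_{n+3} gives two short expansions that share only
P_{n+6}, P_{n+4} and P_{n+2}. The shift by 3 keeps the arbitrary β 0 out. -/
theorem map_X_pow_five_mul (h : IsOrthogonalFor L P β) (n : ℕ) :
    L (X ^ 5 * (P (n + 4) * P (n + 3))) = β (n + 4) * (β (n + 6) * β (n + 5)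
      + (β (n + 5) + β (n + 4)) * (β (n + 5) + β (n + 4) + β (n + 3))
      + β (n + 3) * (β (n + 4) + β (n + 3) + β (n + 2))) * L (P (n + 3) * P (n + 3)) := by
  have r := fun k => h.recurrence.X_mul k
  have e₁ : X ^ 2 * P (n + 4) = P (n + 6) + C (β (n + 5) + β (n + 4)) * P (n + 4)
      + C (β (n + 4) * β (n + 3)) * P (n + 2) := by
    simp only [C_add, C_mul]
    linear_combination X * r (n + 3) + r (n + 4) + C (β (n + 4)) * r (n + 2)
  have e₂ : X ^ 3 * P (n + 3) = P (n + 6) + C (β (n + 5) + β (n + 4) + β (n + 3)) * P (n + 4)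
      + C (β (n + 3) * (β (n + 4) + β (n + 3) + β (n + 2))) * P (n + 2)
      + C (β (n + 3) * β (n + 2) * β (n + 1)) * P n := by
    simp only [C_add, C_mul]
    linear_combination X ^ 2 * r (n + 2) + X * r (n + 3) + r (n + 4)
      + C (β (n + 4)) * r (n + 2) + C (β (n + 3)) * X * r (n + 1) + C (β (n + 3)) * r (n + 2)
      + C (β (n + 3)) * C (β (n + 2)) * r n
  have ho := h.orthogonal
  have hn₃ : L (P (n + 3) * P (n + 3)) = β (n + 3) * L (P (n + 2) * P (n + 2)) := h.norm_succ _
  have hn₄ : L (P (n + 4) * P (n + 4)) = β (n + 4) * L (P (n + 3) * P (n + 3)) := h.norm_succ _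
  have hn₅ : L (P (n + 5) * P (n + 5)) = β (n + 5) * L (P (n + 4) * P (n + 4)) := h.norm_succ _
  have hn₆ : L (P (n + 6) * P (n + 6)) = β (n + 6) * L (P (n + 5) * P (n + 5)) := h.norm_succ _
  rw [show X ^ 5 * (P (n + 4) * P (n + 3)) = X ^ 2 * P (n + 4) * (X ^ 3 * P (n + 3)) by ring,
    e₁, e₂]
  have hexp : ∀ (a₁ a₂ b₁ b₂ b₃ : ℝ) (p q r s : ℝ[X]),
      L ((p + C a₁ * q + C a₂ * r) * (p + C b₁ * q + C b₂ * r + C b₃ * s)) =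
        L (p * p) + b₁ * L (p * q) + b₂ * L (p * r) + b₃ * L (p * s)
        + a₁ * (L (q * p) + b₁ * L (q * q) + b₂ * L (q * r) + b₃ * L (q * s))
        + a₂ * (L (r * p) + b₁ * L (r * q) + b₂ * L (r * r) + b₃ * L (r * s)) := by
    intro a₁ a₂ b₁ b₂ b₃ p q r s
    simp only [← map_C_mul, ← map_add]
    congr 1
    ring
  rw [hexp]
  rw [ho (n + 6) (n + 4) (by omega), ho (n + 6) (n + 2) (by omega), ho (n + 6) n (by omega),
    ho (n + 4) (n + 6) (by omega), ho (n + 4) (n + 2) (by omega), ho (n + 4) n (by omega),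
    ho (n + 2) (n + 6) (by omega), ho (n + 2) (n + 4) (by omega), ho (n + 2) n (by omega),
    hn₆, hn₅, hn₄, hn₃]
  ring

/-- The discrete string equation of the sextic Freud weight. -/
theorem string_equation (h : IsOrthogonalFor L P β) {t lam : ℝ}
    (hL : ∀ r, L (pearsonOp t lam r) = 0) (n : ℕ) :
    6 * β (n + 4) * (β (n + 6) * β (n + 5)
      + (β (n + 5) + β (n + 4)) * (β (n + 5) + β (n + 4) + β (n + 3))
      + β (n + 3) * (β (n + 4) + β (n + 3) + β (n + 2))) - 2 * t * β (n + 4)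
      = (n + 4) + (if Odd (n + 4) then 2 * lam + 1 else 0) := by
  -- With X r = P_{n+4} P_{n+3}, the three terms of `pearsonOp` give n + 4, the parity term and the
  -- cubic side, each times the norm of P_{n+3}.
  obtain ⟨r, hr, hLr⟩ := h.exists_mul_eq_X_mul (n + 3)
  have h0 := hL r
  have hd := h.map_derivative_mul (n + 3)
  have h1 := h.map_X_mul (n + 3)
  have h5 := h.map_X_pow_five_mul n
  have hpos := h.norm_pos (n + 3)
  simp only [show n + 3 + 1 = n + 4 by ring] at hr hLr hd h1
  rw [pearsonOp, ← hr, map_sub, map_add, map_C_mul, hd, hLr,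
    show P (n + 4) * P (n + 3) * (C 6 * X ^ 5 - C (2 * t) * X) =
      C 6 * (X ^ 5 * (P (n + 4) * P (n + 3))) - C (2 * t) * (X * (P (n + 4) * P (n + 3))) by ring,
    map_sub, map_C_mul, map_C_mul, h1, h5] at h0
  refine mul_right_cancel₀ hpos.ne' ?_
  push_cast at h0 ⊢
  split_ifs at h0 ⊢ <;> linear_combination -h0

end IsOrthogonalFor

theorem isOrthogonalFor_of_isMonicOrthogonal {w : ℝ → ℝ} {P : ℕ → ℝ[X]} {β : ℕ → ℝ}
    (h : IsMonicOrthogonal w P) (hβ : IsRecurrenceCoeff P β) :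
    IsOrthogonalFor (momentFunctional w h.integrable) P β where
  recurrence := hβ
  orthogonal m n hmn := by
    simpa [momentFunctional_apply] using h.orthogonal m n hmn
  norm_pos n := by
    simpa [momentFunctional_apply] using h.norm_pos n

theorem exists_isMonicOrthogonal (t : ℝ) {lam : ℝ} (hlam : -1 < lam) :
    ∃ (P : ℕ → ℝ[X]) (β : ℕ → ℝ),
      IsMonicOrthogonal (sexticFreudWeight t lam) P ∧ IsRecurrenceCoeff P β := by
  have hw := integrable_eval_mul_weight t hlam
  set L := momentFunctional _ hw with hLdef
  have heven : ∀ p : ℝ[X], L (p.comp (-X)) = L p :=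
    momentFunctional_comp_neg hw (sexticFreudWeight_neg t lam)
  have hpos : ∀ p : ℝ[X], p ≠ 0 → 0 < L (p * p) := by
    intro p hp
    refine momentFunctional_mul_self_pos hw (fun x hx => ?_) ?_ hp
    · have := abs_pos.2 hx
      unfold sexticFreudWeight
      positivity
    · unfold sexticFreudWeight
      positivity
  have hrec := isRecurrenceCoeff_orthogonalPoly L
  have horth : ∀ m n, m < n → L (orthogonalPoly L m * orthogonalPoly L n) = 0 :=
    fun m n hmn => (orthogonalPoly_orthogonal heven hpos n).1 m hmn
  refine ⟨orthogonalPoly L, orthogonalCoeff L, ⟨hw, fun n => (hrec.monic_natDegree n).1.1,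
    fun n => (hrec.monic_natDegree n).1.2, fun m n hmn => ?_, fun n => ?_⟩, hrec⟩
  · have : L (orthogonalPoly L m * orthogonalPoly L n) = 0 := by
      rcases lt_or_gt_of_ne hmn with h | h
      · exact horth m n h
      · rw [mul_comm]; exact horth n m h
    simpa [hLdef, momentFunctional_apply] using this
  · simpa [hLdef, momentFunctional_apply] using
      hpos _ (hrec.monic_natDegree n).1.1.ne_zero

/-! ### A decay lemma for diagonally dominant recursions -/

/-- Each use of the step gains a factor θ, at the price of looking 2 further in both directions:
hence the range n ≥ m + 2k and the bound K(n + 2k). The last term is the fixed point of s ↦ θs +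
C/m². -/
theorem bound_of_contracting_step {v : ℕ → ℝ} {θ C K : ℝ} {N : ℕ} (hθ₀ : 0 ≤ θ) (hθ₁ : θ < 1)
    (hC : 0 ≤ C) (hK : 0 ≤ K) (hv : ∀ n ≥ N, v n ≤ K * n)
    (hstep : ∀ n ≥ N, ∀ M, v (n - 2) ≤ M → v (n - 1) ≤ M → v (n + 1) ≤ M → v (n + 2) ≤ M →
      v n ≤ θ * M + C / (n : ℝ) ^ 2) {m : ℕ} (hm : N ≤ m) (hm0 : 0 < m) (k : ℕ) :
    ∀ n ≥ m + 2 * k, v n ≤ θ ^ k * (K * (n + 2 * k)) + C / (1 - θ) / (m : ℝ) ^ 2 := by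
  have h1θ : 0 < 1 - θ := by linarith
  have hmR : (0 : ℝ) < m := by exact_mod_cast hm0
  induction k with
  | zero =>
    intro n hn
    have := hv n (by omega)
    have h2 : 0 ≤ C / (1 - θ) / (m : ℝ) ^ 2 := by positivity
    simp only [pow_zero, one_mul, Nat.cast_zero, mul_zero, add_zero]
    linarith
  | succ k ih =>
    intro n hn
    set M := θ ^ k * (K * ((n + 2 : ℕ) + 2 * k)) + C / (1 - θ) / (m : ℝ) ^ 2 with hM
    have hle : ∀ j, m + 2 * k ≤ j → j ≤ n + 2 → v j ≤ M := by
      intro j hj hj'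
      refine (ih j hj).trans ?_
      have : (j : ℝ) ≤ (n + 2 : ℕ) := by exact_mod_cast hj'
      rw [hM]
      gcongr
    have h := hstep n (by omega) M (hle _ (by omega) (by omega)) (hle _ (by omega) (by omega))
      (hle _ (by omega) (by omega)) (hle _ (by omega) (by omega))
    have hn' : C / (n : ℝ) ^ 2 ≤ C / (m : ℝ) ^ 2 := by
      have : (m : ℝ) ≤ n := by exact_mod_cast (by omega)
      gcongr
    have hid : θ * (C / (1 - θ) / (m : ℝ) ^ 2) + C / (m : ℝ) ^ 2 = C / (1 - θ) / (m : ℝ) ^ 2 := by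
      field_simp
      ring
    calc v n ≤ θ * M + C / (m : ℝ) ^ 2 := by linarith
      _ = θ ^ (k + 1) * (K * (n + 2 * ((k + 1 : ℕ) : ℝ))) +
          (θ * (C / (1 - θ) / (m : ℝ) ^ 2) + C / (m : ℝ) ^ 2) := by
        rw [hM]; push_cast; ring
      _ = _ := by rw [hid]

theorem exists_bound_of_contracting_step {v : ℕ → ℝ} {θ C K : ℝ} {N : ℕ} (hθ₀ : 0 ≤ θ)
    (hθ₁ : θ < 1) (hC : 0 ≤ C) (hK : 0 ≤ K) (hv : ∀ n ≥ N, v n ≤ K * n)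
    (hstep : ∀ n ≥ N, ∀ M, v (n - 2) ≤ M → v (n - 1) ≤ M → v (n + 1) ≤ M → v (n + 2) ≤ M →
      v n ≤ θ * M + C / (n : ℝ) ^ 2) :
    ∃ D, ∀ᶠ n : ℕ in atTop, v n ≤ D / (n : ℝ) ^ 2 := by
  have h1θ : 0 < 1 - θ := by linarith
  have hlim : Tendsto (fun k : ℕ => (k : ℝ) ^ 3 * θ ^ k) atTop (𝓝 0) :=
    tendsto_pow_const_mul_const_pow_of_abs_lt_one 3 (by rwa [abs_of_nonneg hθ₀])
  have hk : Tendsto (fun n : ℕ => n / 4) atTop atTop :=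
    Nat.tendsto_div_const_atTop (by norm_num)
  -- Iterating k = n/4 times leaves m = n - 2k ≥ n/2, whence the 4. As n ≤ 7k, the constant 686 =
  -- 2·7³ comes from 2n³θ^k ≤ 686 k³θ^k, where eventually k³θ^k < 1.
  refine ⟨K * 686 + 4 * (C / (1 - θ)), ?_⟩
  filter_upwards [(hlim.comp hk).eventually (gt_mem_nhds one_pos), eventually_ge_atTop (2 * N + 4)]
    with n hn hnN
  set k := n / 4 with hkdef
  simp only [Function.comp_apply] at hn
  have hk1 : 1 ≤ k := by omega
  have h := bound_of_contracting_step hθ₀ hθ₁ hC hK hv hstep (m := n - 2 * k) (by omega) (by omega) k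
    n (by omega)
  have hnpos : (0 : ℝ) < n := by exact_mod_cast (by omega : 0 < n)
  have hm : (n : ℝ) / 2 ≤ ((n - 2 * k : ℕ) : ℝ) := by
    rw [div_le_iff₀ two_pos]
    exact_mod_cast (by omega)
  have h7 : (n : ℝ) ≤ 7 * k := by exact_mod_cast (by omega)
  have hkn : 2 * (k : ℝ) ≤ n := by exact_mod_cast (by omega)
  have hθk : 0 ≤ θ ^ k := by positivity
  have h₁ : θ ^ k * (K * (n + 2 * k)) ≤ K * 686 / (n : ℝ) ^ 2 := by
    rw [le_div_iff₀ (by positivity)]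
    calc θ ^ k * (K * (n + 2 * k)) * (n : ℝ) ^ 2 ≤ θ ^ k * (K * (n + n)) * (n : ℝ) ^ 2 := by
          gcongr
      _ = 2 * K * (θ ^ k * (n : ℝ) ^ 3) := by ring
      _ ≤ 2 * K * (θ ^ k * (7 * k) ^ 3) := by gcongr
      _ = 686 * K * ((k : ℝ) ^ 3 * θ ^ k) := by ring
      _ ≤ 686 * K * 1 := by gcongr
      _ = K * 686 := by ring
  have h₂ : C / (1 - θ) / ((n - 2 * k : ℕ) : ℝ) ^ 2 ≤ 4 * (C / (1 - θ)) / (n : ℝ) ^ 2 := by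
    calc C / (1 - θ) / ((n - 2 * k : ℕ) : ℝ) ^ 2 ≤ C / (1 - θ) / ((n : ℝ) / 2) ^ 2 := by gcongr
      _ = _ := by field_simp; norm_num
  rw [add_div]
  linarith

/-! ### The string equation as a cubic form -/

/-- The cubic form on the left of the string equation. -/
def freudCubic (a b z c d : ℝ) : ℝ :=
  6 * z * (d * c + (c + z) * (c + z + b) + b * (z + b + a))

/-- A finite-difference gradient: when both configurations approach a common point, each coefficient
tends to the matching partial derivative. -/
theorem freudCubic_sub (a b z c d a' b' z' c' d' : ℝ) :
    freudCubic a b z c d - freudCubic a' b' z' c' d' =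
      6 * z' * b * (a - a') + 6 * z' * ((c' + z') + (z' + b' + a') + b) * (b - b')
      + (6 * (d * c + (c + z) * (c + z + b) + b * (z + b + a))
        + 6 * z' * ((c + z + b) + (c' + z') + b)) * (z - z')
      + 6 * z' * (d' + (c + z + b) + (c' + z')) * (c - c') + 6 * z' * c * (d - d') := by
  unfold freudCubic; ring

/-- If all five arguments lie in `[a, A]` and the form takes the same value at a configuration
centred at `A` and at one centred at `a`, then `A = a`. -/
theorem freudCubic_extremes {a A v : ℝ} (ha : 0 ≤ a) (haA : a ≤ A) {x y : Fin 4 → ℝ}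
    (hx : ∀ i, x i ∈ Set.Icc a A) (hy : ∀ i, y i ∈ Set.Icc a A)
    (hA : freudCubic (x 0) (x 1) A (x 2) (x 3) = v)
    (haeq : freudCubic (y 0) (y 1) a (y 2) (y 3) = v) : A = a := by
  have hA0 : 0 ≤ A := ha.trans haA
  have h₁ : freudCubic a a A a a ≤ v := by
    rw [← hA]
    have h0 := (hx 0).1
    have h1 := (hx 1).1
    have h2 := (hx 2).1
    have h3 := (hx 3).1
    have := ha.trans h1
    have := ha.trans h2
    have := ha.trans h3
    unfold freudCubic
    gcongr
  have h₂ : v ≤ freudCubic A A a A A := by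
    rw [← haeq]
    have h0 := (hy 0).2
    have h1 := (hy 1).2
    have h2 := (hy 2).2
    have h3 := (hy 3).2
    have := ha.trans (hy 1).1
    have := ha.trans (hy 2).1
    have := ha.trans (hy 3).1
    have := ha.trans (hy 0).1
    unfold freudCubic
    gcongr
  -- The left side is exactly F(a,a,A,a,a) - F(A,A,a,A,A).
  have h₃ : 6 * ((A - a) * (A ^ 2 + a ^ 2)) ≤ 0 := by
    have h := h₁.trans h₂
    unfold freudCubic at h
    nlinarith
  by_contra hne
  have hlt : a < A := lt_of_le_of_ne haA (Ne.symm hne)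
  have : 0 < (A - a) * (A ^ 2 + a ^ 2) := by
    have : 0 < A := ha.trans_lt hlt
    have : 0 < A - a := by linarith
    positivity
  linarith

/-! ### The scale `n ^ (-1/3)` -/

/-- The scale `n ^ (-1/3)`. -/
noncomputable def cbrtInv (n : ℕ) : ℝ := (n : ℝ) ^ (-(1 / 3) : ℝ)

theorem cbrtInv_pos {n : ℕ} (hn : 0 < n) : 0 < cbrtInv n :=
  Real.rpow_pos_of_pos (by exact_mod_cast hn) _

theorem cbrtInv_pow (n k : ℕ) : cbrtInv n ^ k = (n : ℝ) ^ (-(k / 3) : ℝ) := by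
  rw [cbrtInv, ← Real.rpow_natCast, ← Real.rpow_mul n.cast_nonneg]
  congr 1
  ring

theorem cbrtInv_pow_three_mul {n : ℕ} (hn : 0 < n) : (n : ℝ) * cbrtInv n ^ 3 = 1 := by
  have : (n : ℝ) ≠ 0 := by exact_mod_cast hn.ne'
  rw [cbrtInv_pow]
  norm_num [Real.rpow_neg_one, this]

theorem cbrtInv_le_one {n : ℕ} (hn : 0 < n) : cbrtInv n ≤ 1 :=
  Real.rpow_le_one_of_one_le_of_nonpos (by exact_mod_cast hn) (by norm_num)

theorem tendsto_cbrtInv : Tendsto cbrtInv atTop (𝓝 0) :=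
  (tendsto_rpow_neg_atTop (by norm_num)).comp tendsto_natCast_atTop_atTop

theorem tendsto_index_div {φ : ℕ → ℕ} (h₁ : ∀ n, φ n ≤ n + 2) (h₂ : ∀ n, n ≤ φ n + 2) :
    Tendsto (fun n : ℕ => (φ n : ℝ) / n) atTop (𝓝 1) := by
  have hz : Tendsto (fun n : ℕ => (2 : ℝ) / n) atTop (𝓝 0) :=
    tendsto_const_div_atTop_nhds_zero_nat 2
  have hlo : Tendsto (fun n : ℕ => 1 - (2 : ℝ) / n) atTop (𝓝 1) := by simpa using hz.const_sub 1
  have hhi : Tendsto (fun n : ℕ => 1 + (2 : ℝ) / n) atTop (𝓝 1) := by simpa using hz.const_add 1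
  refine tendsto_of_tendsto_of_tendsto_of_le_of_le' hlo hhi ?_ ?_
  all_goals
    filter_upwards [eventually_gt_atTop 0] with n hn
    have hn' : (0 : ℝ) < n := by exact_mod_cast hn
    have e₁ : (φ n : ℝ) ≤ n + 2 := by exact_mod_cast h₁ n
    have e₂ : (n : ℝ) ≤ φ n + 2 := by exact_mod_cast h₂ n
    field_simp
    linarith

theorem tendsto_index {φ : ℕ → ℕ} (h₂ : ∀ n, n ≤ φ n + 2) : Tendsto φ atTop atTop :=
  tendsto_atTop_mono (fun n => by have := h₂ n; omega) (tendsto_sub_atTop_nat 2)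

theorem tendsto_cbrtInv_div {φ : ℕ → ℕ} (h₁ : ∀ n, φ n ≤ n + 2) (h₂ : ∀ n, n ≤ φ n + 2) :
    Tendsto (fun n : ℕ => cbrtInv n / cbrtInv (φ n)) atTop (𝓝 1) := by
  have h := (tendsto_index_div h₁ h₂).rpow_const (p := (1 / 3 : ℝ)) (Or.inl one_ne_zero)
  rw [Real.one_rpow] at h
  refine h.congr fun n => ?_
  rw [cbrtInv, cbrtInv, Real.rpow_neg n.cast_nonneg, Real.rpow_neg (φ n).cast_nonneg,
    Real.div_rpow (φ n).cast_nonneg n.cast_nonneg, inv_div_inv]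

/-! ### The leading asymptotics -/

/-- A sequence that satisfies the string equation of the sextic Freud weight, where `ρ = 2λ + 1`. -/
structure IsFreudSequence (t ρ : ℝ) (β : ℕ → ℝ) : Prop where
  pos : ∀ n, 0 < n → 0 < β n
  eq : ∀ n, 4 ≤ n → freudCubic (β (n - 2)) (β (n - 1)) (β n) (β (n + 1)) (β (n + 2))
    - 2 * t * β n = n + if Odd n then ρ else 0

namespace IsFreudSequence

variable {t ρ : ℝ} {β : ℕ → ℝ}

theorem scaled_eq (h : IsFreudSequence t ρ β) {n : ℕ} (hn : 4 ≤ n) :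
    freudCubic (β (n - 2) * cbrtInv n) (β (n - 1) * cbrtInv n) (β n * cbrtInv n)
      (β (n + 1) * cbrtInv n) (β (n + 2) * cbrtInv n)
      = 1 + (if Odd n then ρ else 0) * cbrtInv n ^ 3 + 2 * t * cbrtInv n ^ 2 * (β n * cbrtInv n) := by
  have h1 := h.eq n hn
  have h3 := cbrtInv_pow_three_mul (n := n) (by omega)
  unfold freudCubic at h1 ⊢
  linear_combination cbrtInv n ^ 3 * h1 + h3

/-- Dropping the positive neighbours lowers the form to 6y³, so y³ ≤ 1 + |ρ| + 2|t|y, which bounds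
y. -/
theorem scaled_mem_Icc (h : IsFreudSequence t ρ β) {n : ℕ} (hn : 4 ≤ n) :
    β n * cbrtInv n ∈ Set.Icc 0 (1 + 2 * |t| + |ρ|) := by
  have hh := cbrtInv_pos (n := n) (by omega)
  have hh1 := cbrtInv_le_one (n := n) (by omega)
  have hs := h.scaled_eq hn
  have p0 := mul_pos (h.pos n (by omega)) hh
  have p1 := mul_pos (h.pos (n + 1) (by omega)) hh
  have p2 := mul_pos (h.pos (n + 2) (by omega)) hh
  have q1 := mul_pos (h.pos (n - 1) (by omega)) hh
  have q2 := mul_pos (h.pos (n - 2) (by omega)) hh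
  set y := β n * cbrtInv n
  refine ⟨p0.le, ?_⟩
  have hlow : y ^ 3 ≤ freudCubic (β (n - 2) * cbrtInv n) (β (n - 1) * cbrtInv n) y
      (β (n + 1) * cbrtInv n) (β (n + 2) * cbrtInv n) := by
    have : freudCubic 0 0 y 0 0 ≤ freudCubic (β (n - 2) * cbrtInv n) (β (n - 1) * cbrtInv n) y
      (β (n + 1) * cbrtInv n) (β (n + 2) * cbrtInv n) := by
      unfold freudCubic
      gcongr
    refine le_trans ?_ this
    unfold freudCubic
    nlinarith [pow_pos p0 3]
  have hρ : (if Odd n then ρ else 0) * cbrtInv n ^ 3 ≤ |ρ| := by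
    have h3 : cbrtInv n ^ 3 ≤ 1 := pow_le_one₀ hh.le hh1
    have h4 : (if Odd n then ρ else 0) ≤ |ρ| := by
      split_ifs
      exacts [le_abs_self ρ, abs_nonneg ρ]
    calc _ ≤ |ρ| * cbrtInv n ^ 3 := by gcongr
      _ ≤ |ρ| * 1 := by gcongr
      _ = |ρ| := mul_one _
  have ht : 2 * t * cbrtInv n ^ 2 * y ≤ 2 * |t| * y := by
    have h3 : cbrtInv n ^ 2 ≤ 1 := pow_le_one₀ hh.le hh1
    calc 2 * t * cbrtInv n ^ 2 * y ≤ 2 * |t| * cbrtInv n ^ 2 * y := by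
          gcongr; exact le_abs_self t
      _ ≤ 2 * |t| * 1 * y := by gcongr
      _ = _ := by ring
  by_contra! hlt
  have ht0 := abs_nonneg t
  have hρ0 := abs_nonneg ρ
  have hy1 : 1 < y := by linarith
  have h5 : y ^ 3 ≤ 1 + |ρ| + 2 * |t| * y := by linarith
  have h6 : (1 + 2 * |t| + |ρ|) * y < y ^ 3 := by
    have : (1 + 2 * |t| + |ρ|) * y < y * y := by gcongr
    have : y * y ≤ y * y * y := le_mul_of_one_le_right (by positivity) hy1.le
    calc _ < y * y := by assumption
      _ ≤ y * y * y := this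
      _ = y ^ 3 := by ring
  nlinarith

theorem tendsto_neighbour {l : Filter ℕ} (hl : l ≤ atTop) {φ : ℕ → ℕ} (h₁ : ∀ n, φ n ≤ n + 2)
    (h₂ : ∀ n, n ≤ φ n + 2) {x : ℝ}
    (hx : Tendsto (fun n => β (φ n) * cbrtInv (φ n)) l (𝓝 x)) :
    Tendsto (fun n => β (φ n) * cbrtInv n) l (𝓝 x) := by
  have h := hx.mul ((tendsto_cbrtInv_div h₁ h₂).mono_left hl)
  rw [mul_one] at h
  refine h.congr' (hl ?_)
  filter_upwards [eventually_gt_atTop 2] with n hn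
  have hne : cbrtInv (φ n) ≠ 0 := (cbrtInv_pos (by have := h₂ n; omega)).ne'
  field_simp

/-- An ultrafilter makes all bounded neighbour sequences converge at once, replacing successive
subsequences. The limit is a cluster point of the original sequence because U pushed forward by φ
still tends to infinity. -/
theorem exists_tendsto_neighbour (h : IsFreudSequence t ρ β) {U : Ultrafilter ℕ}
    (hU : (U : Filter ℕ) ≤ atTop) {φ : ℕ → ℕ} (h₁ : ∀ n, φ n ≤ n + 2) (h₂ : ∀ n, n ≤ φ n + 2) :
    ∃ x, MapClusterPt x atTop (fun n => β n * cbrtInv n) ∧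
      Tendsto (fun n => β (φ n) * cbrtInv n) U (𝓝 x) := by
  have hφ : Tendsto φ U atTop := (tendsto_index h₂).mono_left hU
  have hmem : ∀ᶠ n in (U : Filter ℕ), β (φ n) * cbrtInv (φ n) ∈ Set.Icc 0 (1 + 2 * |t| + |ρ|) :=
    (hφ.eventually (eventually_ge_atTop 4)).mono fun n hn => h.scaled_mem_Icc hn
  obtain ⟨x, -, hx⟩ := isCompact_Icc.ultrafilter_le_nhds'
    (U.map fun n => β (φ n) * cbrtInv (φ n)) hmem
  refine ⟨x, ?_, tendsto_neighbour hU h₁ h₂ hx⟩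
  exact mapClusterPt_iff_ultrafilter.2 ⟨U.map φ, hφ, hx⟩

theorem exists_freudCubic_eq_one (h : IsFreudSequence t ρ β) {y : ℝ}
    (hy : MapClusterPt y atTop fun n => β n * cbrtInv n) :
    ∃ x : Fin 4 → ℝ, (∀ i, MapClusterPt (x i) atTop fun n => β n * cbrtInv n) ∧
      freudCubic (x 0) (x 1) y (x 2) (x 3) = 1 := by
  obtain ⟨U, hU, hUy⟩ := mapClusterPt_iff_ultrafilter.1 hy
  obtain ⟨a, ha, ha'⟩ := h.exists_tendsto_neighbour hU (φ := fun n => n - 2)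
    (fun n => by omega) (fun n => by omega)
  obtain ⟨b, hb, hb'⟩ := h.exists_tendsto_neighbour hU (φ := fun n => n - 1)
    (fun n => by omega) (fun n => by omega)
  obtain ⟨c, hc, hc'⟩ := h.exists_tendsto_neighbour hU (φ := fun n => n + 1)
    (fun n => by omega) (fun n => by omega)
  obtain ⟨d, hd, hd'⟩ := h.exists_tendsto_neighbour hU (φ := fun n => n + 2)
    (fun n => by omega) (fun n => by omega)
  refine ⟨![a, b, c, d], fun i => by fin_cases i <;> assumption, ?_⟩
  have hcub : Tendsto (fun n => freudCubic (β (n - 2) * cbrtInv n) (β (n - 1) * cbrtInv n)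
      (β n * cbrtInv n) (β (n + 1) * cbrtInv n) (β (n + 2) * cbrtInv n)) U
      (𝓝 (freudCubic a b y c d)) :=
    (hUy.const_mul 6).mul (((hd'.mul hc').add ((hc'.add hUy).mul ((hc'.add hUy).add hb'))).add
      (hb'.mul ((hUy.add hb').add ha')))
  have hh : Tendsto cbrtInv U (𝓝 0) := tendsto_cbrtInv.mono_left hU
  have hρ : Tendsto (fun n => (if Odd n then ρ else 0) * cbrtInv n ^ 3) U (𝓝 0) := by
    have h0 : Tendsto (fun n => |ρ| * cbrtInv n ^ 3) U (𝓝 0) := by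
      simpa using (hh.pow 3).const_mul |ρ|
    refine squeeze_zero_norm' (hU ?_) h0
    filter_upwards [eventually_gt_atTop 0] with n hn
    have := cbrtInv_pos hn
    rw [norm_mul, Real.norm_of_nonneg (r := cbrtInv n ^ 3) (by positivity)]
    gcongr
    split_ifs <;> simp
  have hrhs : Tendsto (fun n => 1 + (if Odd n then ρ else 0) * cbrtInv n ^ 3
      + 2 * t * cbrtInv n ^ 2 * (β n * cbrtInv n)) U (𝓝 1) := by
    simpa using (hρ.const_add 1).add (((hh.pow 2).const_mul (2 * t)).mul hUy)
  refine tendsto_nhds_unique hcub (hrhs.congr' (hU ?_))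
  filter_upwards [eventually_ge_atTop 4] with n hn
  exact (h.scaled_eq hn).symm

theorem tendsto_scaled (h : IsFreudSequence t ρ β) {X : ℝ} (hX0 : 0 < X) (hX : 60 * X ^ 3 = 1) :
    Tendsto (fun n => β n * cbrtInv n) atTop (𝓝 X) := by
  have hmem : ∀ᶠ n in atTop, β n * cbrtInv n ∈ Set.Icc 0 (1 + 2 * |t| + |ρ|) :=
    (eventually_ge_atTop 4).mono fun n hn => h.scaled_mem_Icc hn
  set S := {x : ℝ | MapClusterPt x atTop fun n => β n * cbrtInv n} with hS
  have hSsub : S ⊆ Set.Icc 0 (1 + 2 * |t| + |ρ|) := fun x hx =>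
    isClosed_Icc.mem_of_mapClusterPt hx hmem
  have hScpt : IsCompact S := isCompact_Icc.of_isClosed_subset isClosed_setOfPred_clusterPt hSsub
  have hSne : S.Nonempty := by
    obtain ⟨x, -, hx⟩ := isCompact_Icc.exists_mapClusterPt_of_frequently hmem.frequently
    exact ⟨x, hx⟩
  obtain ⟨A, hAS, hA⟩ := hScpt.exists_isGreatest hSne
  obtain ⟨a, haS, ha⟩ := hScpt.exists_isLeast hSne
  obtain ⟨x, hx, hxA⟩ := h.exists_freudCubic_eq_one hAS
  obtain ⟨y, hy, hya⟩ := h.exists_freudCubic_eq_one haS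
  have hAa : A = a := freudCubic_extremes (hSsub haS).1 (ha hAS)
    (fun i => ⟨ha (hx i), hA (hx i)⟩) (fun i => ⟨ha (hy i), hA (hy i)⟩) hxA hya
  have hconst : ∀ z ∈ S, z = A := fun z hz => le_antisymm (hA hz) (hAa ▸ ha hz)
  have hAX : A = X := by
    rw [hconst _ (hx 0), hconst _ (hx 1), hconst _ (hx 2), hconst _ (hx 3)] at hxA
    have h60 : 60 * A ^ 3 = 1 := by rw [← hxA]; unfold freudCubic; ring
    exact (pow_left_inj₀ (hSsub hAS).1 hX0.le (by norm_num : (3 : ℕ) ≠ 0)).1 (by linarith)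
  exact isCompact_Icc.tendsto_nhds_of_unique_mapClusterPt hmem
    fun z _ hz => (hconst z hz).trans hAX

end IsFreudSequence

/-! ### Truncated expansions in powers of `n ^ (-1/3)` -/

/-- Second order suffices: it is applied at x = j h³, where the remainder is O(h⁹). -/
theorem one_add_rpow_sub_isBigO (s : ℝ) :
    (fun x : ℝ => (1 + x) ^ s - (1 + s * x + s * (s - 1) / 2 * x ^ 2)) =O[𝓝 0] fun x => x ^ 3 := by
  have h := (Real.one_add_rpow_hasFPowerSeriesAt_zero (a := s)).isBigO_sub_partialSum_pow 3
  have hc : Ring.choose s 2 = s * (s - 1) / 2 := by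
    have h2 := Ring.descPochhammer_eq_factorial_smul_choose s 2
    simp [descPochhammer_succ_right, Polynomial.smeval_sub, Polynomial.smeval_mul] at h2
    linarith
  simp only [zero_add, FormalMultilinearSeries.partialSum, binomialSeries_apply,
    Finset.sum_range_succ, Finset.sum_range_zero, hc] at h
  refine ((h.congr_left fun x => ?_).trans (IsBigO.of_bound 1 ?_))
  · simp [List.ofFn_succ]
    ring_nf
    simp
  · simp

/-- `f n = a₀ + a₂ h² + a₃ h³ + a₄ h⁴ + a₅ h⁵ + a₆ h⁶ + O(h⁷)`, where `h = n ^ (-1/3)`. -/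
def HasTruncExpansion (f : ℕ → ℝ) (a₀ a₂ a₃ a₄ a₅ a₆ : ℝ) : Prop :=
  (fun n => f n - (a₀ + a₂ * cbrtInv n ^ 2 + a₃ * cbrtInv n ^ 3 + a₄ * cbrtInv n ^ 4
    + a₅ * cbrtInv n ^ 5 + a₆ * cbrtInv n ^ 6)) =O[atTop] fun n => cbrtInv n ^ 7

theorem isBigO_cbrtInv_pow {j k : ℕ} (h : j ≤ k) :
    (fun n => cbrtInv n ^ k) =O[atTop] fun n => cbrtInv n ^ j := by
  refine IsBigO.of_bound 1 ?_
  filter_upwards [eventually_gt_atTop 0] with n hn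
  have := cbrtInv_pos hn
  rw [Real.norm_of_nonneg (by positivity), Real.norm_of_nonneg (by positivity), one_mul]
  exact pow_le_pow_of_le_one this.le (cbrtInv_le_one hn) h

theorem isBigO_cbrtInv_pow_one (k : ℕ) :
    (fun n => cbrtInv n ^ k) =O[atTop] fun _ => (1 : ℝ) := by
  simpa using isBigO_cbrtInv_pow k.zero_le

namespace HasTruncExpansion

variable {f g : ℕ → ℝ} {a₀ a₂ a₃ a₄ a₅ a₆ b₀ b₂ b₃ b₄ b₅ b₆ : ℝ}

theorem of_poly : HasTruncExpansion (fun n => a₀ + a₂ * cbrtInv n ^ 2 + a₃ * cbrtInv n ^ 3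
    + a₄ * cbrtInv n ^ 4 + a₅ * cbrtInv n ^ 5 + a₆ * cbrtInv n ^ 6) a₀ a₂ a₃ a₄ a₅ a₆ := by
  unfold HasTruncExpansion
  simpa using isBigO_zero _ _

theorem add (hf : HasTruncExpansion f a₀ a₂ a₃ a₄ a₅ a₆)
    (hg : HasTruncExpansion g b₀ b₂ b₃ b₄ b₅ b₆) :
    HasTruncExpansion (fun n => f n + g n) (a₀ + b₀) (a₂ + b₂) (a₃ + b₃) (a₄ + b₄) (a₅ + b₅)
      (a₆ + b₆) := by
  refine (IsBigO.add hf hg).congr_left fun n => ?_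
  ring

theorem poly_isBigO_one (a₀ a₂ a₃ a₄ a₅ a₆ : ℝ) :
    (fun n => a₀ + a₂ * cbrtInv n ^ 2 + a₃ * cbrtInv n ^ 3 + a₄ * cbrtInv n ^ 4
      + a₅ * cbrtInv n ^ 5 + a₆ * cbrtInv n ^ 6) =O[atTop] fun _ => (1 : ℝ) := by
  have h := fun (k : ℕ) (a : ℝ) => (isBigO_cbrtInv_pow_one k).const_mul_left a
  exact ((((((isBigO_const_const a₀ one_ne_zero _).add (h 2 a₂)).add (h 3 a₃)).add (h 4 a₄)).add
    (h 5 a₅)).add (h 6 a₆))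

theorem tendsto (hf : HasTruncExpansion f a₀ a₂ a₃ a₄ a₅ a₆) : Tendsto f atTop (𝓝 a₀) := by
  have hp : ∀ (k : ℕ) (a : ℝ), k ≠ 0 → Tendsto (fun n => a * cbrtInv n ^ k) atTop (𝓝 0) := by
    intro k a hk
    simpa [hk] using (tendsto_cbrtInv.pow k).const_mul a
  have h7 : Tendsto (fun n => cbrtInv n ^ 7) atTop (𝓝 0) := by
    simpa using (tendsto_cbrtInv.pow 7)
  have h := (hf.trans_tendsto h7).add (((((tendsto_const_nhds (x := a₀)).add
    (hp 2 a₂ (by norm_num))).add (hp 3 a₃ (by norm_num))).add (hp 4 a₄ (by norm_num))).add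
    (hp 5 a₅ (by norm_num)) |>.add (hp 6 a₆ (by norm_num)))
  simpa using h

theorem mul (hf : HasTruncExpansion f a₀ a₂ a₃ a₄ a₅ a₆)
    (hg : HasTruncExpansion g b₀ b₂ b₃ b₄ b₅ b₆) :
    HasTruncExpansion (fun n => f n * g n) (a₀ * b₀) (a₀ * b₂ + a₂ * b₀) (a₀ * b₃ + a₃ * b₀)
      (a₀ * b₄ + a₂ * b₂ + a₄ * b₀) (a₀ * b₅ + a₂ * b₃ + a₃ * b₂ + a₅ * b₀)
      (a₀ * b₆ + a₂ * b₄ + a₃ * b₃ + a₄ * b₂ + a₆ * b₀) := by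
  have h₁ := IsBigO.mul hf (hg.tendsto.isBigO_one ℝ)
  have h₂ := (poly_isBigO_one a₀ a₂ a₃ a₄ a₅ a₆).mul hg
  -- These are the product terms of order 7 and 9 to 12, with h⁷ factored out. Order 8 needs `h₄`,
  -- since the truncated form has no linear term.
  have h₃ := (isBigO_refl (fun n => cbrtInv n ^ 7) atTop).mul (poly_isBigO_one
    (a₂ * b₅ + a₃ * b₄ + a₄ * b₃ + a₅ * b₂) (a₃ * b₆ + a₄ * b₅ + a₅ * b₄ + a₆ * b₃)
    (a₄ * b₆ + a₅ * b₅ + a₆ * b₄) (a₅ * b₆ + a₆ * b₅) (a₆ * b₆) 0)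
  have h₄ := (isBigO_cbrtInv_pow (show 7 ≤ 8 by norm_num)).const_mul_left
    (a₂ * b₆ + a₃ * b₅ + a₄ * b₄ + a₅ * b₃ + a₆ * b₂)
  simp only [mul_one, one_mul] at h₁ h₂ h₃
  refine (((h₁.add h₂).add h₃).add h₄).congr_left fun n => ?_
  ring

theorem isBigO_of_eq_zero (hf : HasTruncExpansion f a₀ a₂ a₃ a₄ a₅ a₆) (h₀ : a₀ = 0) (h₂ : a₂ = 0)
    (h₃ : a₃ = 0) (h₄ : a₄ = 0) (h₅ : a₅ = 0) (h₆ : a₆ = 0) :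
    f =O[atTop] fun n => cbrtInv n ^ 7 := by
  subst h₀ h₂ h₃ h₄ h₅ h₆
  exact hf.congr_left fun n => by simp

end HasTruncExpansion

/-- A combination of the powers of `x` that occur in the expansion of the coefficients. -/
noncomputable def cbrtExpansion (c₁ c₂ c₃ c₅ c₆ x : ℝ) : ℝ :=
  c₁ * x ^ (1 / 3 : ℝ) + c₂ * x ^ (-(1 / 3) : ℝ) + c₃ * x ^ (-(2 / 3) : ℝ)
    + c₅ * x ^ (-(4 / 3) : ℝ) + c₆ * x ^ (-(5 / 3) : ℝ)

theorem rpow_add_sub_isBigO (s j : ℝ) :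
    (fun n : ℕ => (1 + j * cbrtInv n ^ 3) ^ s - (1 + s * j * cbrtInv n ^ 3
      + s * (s - 1) / 2 * j ^ 2 * cbrtInv n ^ 6)) =O[atTop] fun n => cbrtInv n ^ 7 := by
  have ht : Tendsto (fun n => j * cbrtInv n ^ 3) atTop (𝓝 0) := by
    simpa using (tendsto_cbrtInv.pow 3).const_mul j
  have h := (one_add_rpow_sub_isBigO s).comp_tendsto ht
  have h9 : (fun n => (j * cbrtInv n ^ 3) ^ 3) =O[atTop] fun n => cbrtInv n ^ 7 := by
    refine ((isBigO_cbrtInv_pow (show 7 ≤ 9 by norm_num)).const_mul_left (j ^ 3)).congr_left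
      fun n => ?_
    ring
  refine (h.trans h9).congr_left fun n => ?_
  simp only [Function.comp_apply]
  ring

/-- Since n + j = n(1 + j h³), a shift moves contributions up in steps of three orders. The
unshifted terms have orders 0, 2, 3, 5, 6, so order 4 stays empty. -/
theorem hasTruncExpansion_cbrtExpansion (c₁ c₂ c₃ c₅ c₆ j : ℝ) :
    HasTruncExpansion (fun n => cbrtExpansion c₁ c₂ c₃ c₅ c₆ (n + j) * cbrtInv n)
      c₁ c₂ (c₁ * j / 3 + c₃) 0 (c₅ - c₂ * j / 3) (c₆ - c₁ * j ^ 2 / 9 - 2 / 3 * j * c₃) := by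
  have hr := fun s => rpow_add_sub_isBigO s j
  have hpw := fun k => isBigO_cbrtInv_pow_one k
  have key : ∀ n : ℕ, 0 < n → 0 < (n : ℝ) + j → ∀ (s : ℝ) ,
      ((n : ℝ) + j) ^ s = (n : ℝ) ^ s * (1 + j * cbrtInv n ^ 3) ^ s := by
    intro n hn hj s
    have h3 := cbrtInv_pow_three_mul hn
    have hnR : (0 : ℝ) < n := by exact_mod_cast hn
    have hfac : (n : ℝ) + j = n * (1 + j * cbrtInv n ^ 3) := by linear_combination (-j) * h3
    have hp : 0 ≤ 1 + j * cbrtInv n ^ 3 := by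
      rw [hfac] at hj
      exact (pos_of_mul_pos_right hj hnR.le).le
    rw [hfac, Real.mul_rpow hnR.le hp]
  have h1 := (hr (1 / 3)).const_mul_left c₁
  have h2 := ((hpw 2).mul (hr (-(1 / 3)))).const_mul_left c₂
  have h3 := ((hpw 3).mul (hr (-(2 / 3)))).const_mul_left c₃
  have h5 := ((hpw 5).mul (hr (-(4 / 3)))).const_mul_left c₅
  have h6 := ((hpw 6).mul (hr (-(5 / 3)))).const_mul_left c₆
  have h8 := fun (k : ℕ) (hk : 7 ≤ k) (a : ℝ) => (isBigO_cbrtInv_pow hk).const_mul_left a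
  simp only [one_mul] at h1 h2 h3 h5 h6
  have hsum := ((((h1.add h2).add h3).add h5).add h6).add ((((((h8 8 (by norm_num)
    (c₂ * (2 / 9) * j ^ 2)).add (h8 9 (by norm_num) (c₃ * (5 / 9) * j ^ 2))).add
    (h8 8 (by norm_num) (-(4 / 3) * c₅ * j))).add (h8 11 (by norm_num) (c₅ * (14 / 9) * j ^ 2))).add
    (h8 9 (by norm_num) (-(5 / 3) * c₆ * j))).add (h8 12 (by norm_num) (c₆ * (20 / 9) * j ^ 2)))
  have hev : ∀ᶠ n : ℕ in atTop, 0 < (n : ℝ) + j := by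
    filter_upwards [tendsto_natCast_atTop_atTop.eventually (eventually_gt_atTop (-j))] with n hn
    linarith
  refine hsum.congr' ?_ EventuallyEq.rfl
  filter_upwards [hev, eventually_gt_atTop 0] with n hj hn
  have hnR : (n : ℝ) ≠ 0 := by exact_mod_cast hn.ne'
  have e1 : (n : ℝ) ^ (1 / 3 : ℝ) * cbrtInv n = 1 := by
    rw [cbrtInv, ← Real.rpow_add (by positivity)]; norm_num
  have e2 : (n : ℝ) ^ (-(1 / 3) : ℝ) = cbrtInv n := rfl
  have e3 : (n : ℝ) ^ (-(2 / 3) : ℝ) = cbrtInv n ^ 2 := by rw [cbrtInv_pow]; norm_num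
  have e5 : (n : ℝ) ^ (-(4 / 3) : ℝ) = cbrtInv n ^ 4 := by rw [cbrtInv_pow]; norm_num
  have e6 : (n : ℝ) ^ (-(5 / 3) : ℝ) = cbrtInv n ^ 5 := by rw [cbrtInv_pow]; norm_num
  simp only [cbrtExpansion, key n hn hj, e2, e3, e5, e6]
  linear_combination (-(c₁ * (1 + j * cbrtInv n ^ 3) ^ (1 / 3 : ℝ))) * e1

/-! ### The expansions solve the string equation asymptotically -/

theorem kappa_pos : 0 < kappa := Real.rpow_pos_of_pos (by norm_num) _

theorem kappa_pow_three : kappa ^ 3 = 60 := by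
  rw [kappa, ← Real.rpow_natCast, ← Real.rpow_mul (by norm_num)]
  norm_num

/-- Makes every coefficient polynomial in κ, so that κ³ = 60 is the only relation needed later. -/
theorem kappa_inv : kappa⁻¹ = kappa ^ 2 / 60 := by
  have := kappa_pos.ne'
  field_simp
  linear_combination -kappa_pow_three

theorem evenExpansion_eq (t lam : ℝ) {x : ℝ} (hx : 0 ≤ x) :
    evenExpansion t lam x = cbrtExpansion (kappa ^ 2 / 60) (t * kappa / 90)
      (-((2 * lam + 1) * kappa ^ 2 / 90)) (-(4 * t * (2 * lam + 1) * kappa / 135))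
      (-((t ^ 3 - 135 * (7 * lam ^ 2 + 7 * lam + 2)) * kappa ^ 2 / 36450)) x := by
  simp only [evenExpansion, cbrtExpansion, Real.rpow_neg hx, div_eq_mul_inv, mul_inv]
  linear_combination x ^ (1 * 3⁻¹ : ℝ) * kappa_inv

theorem oddExpansion_eq (t lam : ℝ) {x : ℝ} (hx : 0 ≤ x) :
    oddExpansion t lam x = cbrtExpansion (kappa ^ 2 / 60) (t * kappa / 90)
      ((2 * lam + 1) * kappa ^ 2 / 60) (7 * t * (2 * lam + 1) * kappa / 270)
      (-((2 * t ^ 3 + 135 * (6 * lam ^ 2 + 6 * lam + 1)) * kappa ^ 2 / 72900)) x := by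
  simp only [oddExpansion, cbrtExpansion, Real.rpow_neg hx, div_eq_mul_inv, mul_inv]
  linear_combination x ^ (1 * 3⁻¹ : ℝ) * kappa_inv

/-- The error of `E` at even and `O` at odd distance from `n` in the scaled string equation. -/
noncomputable def scaledResidual (t γ : ℝ) (E O : ℝ → ℝ) (n : ℕ) : ℝ :=
  freudCubic (E ((n : ℝ) + -2) * cbrtInv n) (O ((n : ℝ) + -1) * cbrtInv n)
    (E ((n : ℝ) + 0) * cbrtInv n) (O ((n : ℝ) + 1) * cbrtInv n) (E ((n : ℝ) + 2) * cbrtInv n)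
    + (-1 + -(2 * t) * cbrtInv n ^ 2 * (E ((n : ℝ) + 0) * cbrtInv n) + -γ * cbrtInv n ^ 3)

namespace HasTruncExpansion

theorem const (a : ℝ) : HasTruncExpansion (fun _ => a) a 0 0 0 0 0 := by
  simpa using of_poly (a₀ := a) (a₂ := 0) (a₃ := 0) (a₄ := 0) (a₅ := 0) (a₆ := 0)

theorem of_sq (a : ℝ) : HasTruncExpansion (fun n => a * cbrtInv n ^ 2) 0 a 0 0 0 0 := by
  simpa using of_poly (a₀ := 0) (a₂ := a) (a₃ := 0) (a₄ := 0) (a₅ := 0) (a₆ := 0)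

theorem of_cube (a : ℝ) : HasTruncExpansion (fun n => a * cbrtInv n ^ 3) 0 0 a 0 0 0 := by
  simpa using of_poly (a₀ := 0) (a₂ := 0) (a₃ := a) (a₄ := 0) (a₅ := 0) (a₆ := 0)

end HasTruncExpansion

open HasTruncExpansion in
theorem scaledResidual_even_isBigO (t lam : ℝ) {k : ℝ} (hk : k ^ 3 = 60) :
    (scaledResidual t 0
      (cbrtExpansion (k ^ 2 / 60) (t * k / 90)
        (-((2 * lam + 1) * k ^ 2 / 90)) (-(4 * t * (2 * lam + 1) * k / 135))
        (-((t ^ 3 - 135 * (7 * lam ^ 2 + 7 * lam + 2)) * k ^ 2 / 36450)))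
      (cbrtExpansion (k ^ 2 / 60) (t * k / 90)
        ((2 * lam + 1) * k ^ 2 / 60) (7 * t * (2 * lam + 1) * k / 270)
        (-((2 * t ^ 3 + 135 * (6 * lam ^ 2 + 6 * lam + 1)) * k ^ 2 / 72900))))
      =O[atTop] fun n => cbrtInv n ^ 7 := by
  have k4 : k ^ 4 = 60 * k := by linear_combination k * hk
  have k5 : k ^ 5 = 60 * k ^ 2 := by linear_combination k ^ 2 * hk
  have k6 : k ^ 6 = 3600 := by linear_combination (k ^ 3 + 60) * hk
  have hE := hasTruncExpansion_cbrtExpansion (k ^ 2 / 60) (t * k / 90)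
        (-((2 * lam + 1) * k ^ 2 / 90)) (-(4 * t * (2 * lam + 1) * k / 135))
        (-((t ^ 3 - 135 * (7 * lam ^ 2 + 7 * lam + 2)) * k ^ 2 / 36450))
  have hO := hasTruncExpansion_cbrtExpansion (k ^ 2 / 60) (t * k / 90)
        ((2 * lam + 1) * k ^ 2 / 60) (7 * t * (2 * lam + 1) * k / 270)
        (-((2 * t ^ 3 + 135 * (6 * lam ^ 2 + 6 * lam + 1)) * k ^ 2 / 72900))
  have a := hE (-2)
  have b := hO (-1)
  have z := hE 0
  have c := hO 1
  have d := hE 2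
  -- The bracketing mirrors `freudCubic` and `scaledResidual`, and `-0` fills the slot of γ = 0.
  -- What remains is the vanishing of the coefficients of orders 0, 2, 3, 4, 5, 6 modulo k³ = 60.
  have h := (((const 6).mul z).mul (((d.mul c).add ((c.add z).mul ((c.add z).add b))).add
    (b.mul ((z.add b).add a)))).add (((const (-1)).add ((of_sq (-(2 * t))).mul z)).add (of_cube (-0)))
  refine h.isBigO_of_eq_zero ?_ ?_ ?_ ?_ ?_ ?_ <;> ring_nf <;> simp only [hk, k4, k5, k6] <;> ring

open HasTruncExpansion in
theorem scaledResidual_odd_isBigO (t lam : ℝ) {k : ℝ} (hk : k ^ 3 = 60) :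
    (scaledResidual t (2 * lam + 1)
      (cbrtExpansion (k ^ 2 / 60) (t * k / 90)
        ((2 * lam + 1) * k ^ 2 / 60) (7 * t * (2 * lam + 1) * k / 270)
        (-((2 * t ^ 3 + 135 * (6 * lam ^ 2 + 6 * lam + 1)) * k ^ 2 / 72900)))
      (cbrtExpansion (k ^ 2 / 60) (t * k / 90)
        (-((2 * lam + 1) * k ^ 2 / 90)) (-(4 * t * (2 * lam + 1) * k / 135))
        (-((t ^ 3 - 135 * (7 * lam ^ 2 + 7 * lam + 2)) * k ^ 2 / 36450))))
      =O[atTop] fun n => cbrtInv n ^ 7 := by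
  have k4 : k ^ 4 = 60 * k := by linear_combination k * hk
  have k5 : k ^ 5 = 60 * k ^ 2 := by linear_combination k ^ 2 * hk
  have k6 : k ^ 6 = 3600 := by linear_combination (k ^ 3 + 60) * hk
  have hO := hasTruncExpansion_cbrtExpansion (k ^ 2 / 60) (t * k / 90)
        (-((2 * lam + 1) * k ^ 2 / 90)) (-(4 * t * (2 * lam + 1) * k / 135))
        (-((t ^ 3 - 135 * (7 * lam ^ 2 + 7 * lam + 2)) * k ^ 2 / 36450))
  have hE := hasTruncExpansion_cbrtExpansion (k ^ 2 / 60) (t * k / 90)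
        ((2 * lam + 1) * k ^ 2 / 60) (7 * t * (2 * lam + 1) * k / 270)
        (-((2 * t ^ 3 + 135 * (6 * lam ^ 2 + 6 * lam + 1)) * k ^ 2 / 72900))
  have a := hE (-2)
  have b := hO (-1)
  have z := hE 0
  have c := hO 1
  have d := hE 2
  have h := (((const 6).mul z).mul (((d.mul c).add ((c.add z).mul ((c.add z).add b))).add
    (b.mul ((z.add b).add a)))).add (((const (-1)).add ((of_sq (-(2 * t))).mul z)).add
    (of_cube (-(2 * lam + 1))))
  refine h.isBigO_of_eq_zero ?_ ?_ ?_ ?_ ?_ ?_ <;> ring_nf <;> simp only [hk, k4, k5, k6] <;> ring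

/-! ### Comparison of the coefficients with the expansions -/

/-- Stability of the string equation: an approximate solution with the right leading term and
residual O(h⁷) lies within O(h⁶) of the true one, by diagonal dominance of the linearisation. -/
theorem IsFreudSequence.isBigO_sub {t ρ X : ℝ} {β b : ℕ → ℝ} (h : IsFreudSequence t ρ β)
    (hX0 : 0 < X) (hX : 60 * X ^ 3 = 1)
    (hb : Tendsto (fun n => b n * cbrtInv n) atTop (𝓝 X))
    (hres : (fun n => freudCubic (b (n - 2) * cbrtInv n) (b (n - 1) * cbrtInv n) (b n * cbrtInv n)
      (b (n + 1) * cbrtInv n) (b (n + 2) * cbrtInv n) - (1 + (if Odd n then ρ else 0) * cbrtInv n ^ 3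
        + 2 * t * cbrtInv n ^ 2 * (b n * cbrtInv n))) =O[atTop] fun n => cbrtInv n ^ 7) :
    (fun n => β n - b n) =O[atTop] fun n : ℕ => 1 / (n : ℝ) ^ 2 := by
  have hβ := h.tendsto_scaled hX0 hX
  have nb : ∀ {s : ℕ → ℝ}, Tendsto (fun n => s n * cbrtInv n) atTop (𝓝 X) →
      ∀ {φ : ℕ → ℕ}, (∀ n, φ n ≤ n + 2) → (∀ n, n ≤ φ n + 2) →
      Tendsto (fun n => s (φ n) * cbrtInv n) atTop (𝓝 X) := fun hs φ h₁ h₂ =>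
    IsFreudSequence.tendsto_neighbour le_rfl h₁ h₂ (hs.comp (tendsto_index h₂))
  have ya := nb hβ (φ := fun n => n - 2) (fun n => by omega) (fun n => by omega)
  have yb := nb hβ (φ := fun n => n - 1) (fun n => by omega) (fun n => by omega)
  have yc := nb hβ (φ := fun n => n + 1) (fun n => by omega) (fun n => by omega)
  have yd := nb hβ (φ := fun n => n + 2) (fun n => by omega) (fun n => by omega)
  have za := nb hb (φ := fun n => n - 2) (fun n => by omega) (fun n => by omega)
  have zb := nb hb (φ := fun n => n - 1) (fun n => by omega) (fun n => by omega)
  have zc := nb hb (φ := fun n => n + 1) (fun n => by omega) (fun n => by omega)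
  have zd := nb hb (φ := fun n => n + 2) (fun n => by omega) (fun n => by omega)
  have ht : Tendsto (fun n => 2 * t * cbrtInv n ^ 2) atTop (𝓝 0) := by
    simpa using (tendsto_cbrtInv.pow 2).const_mul (2 * t)
  have hX2 : 0 < X ^ 2 := by positivity
  have la := ((hb.const_mul 6).mul yb).abs
  have lb := ((hb.const_mul 6).mul (((zc.add hb).add ((hb.add zb).add za)).add yb)).abs
  have lz := (((((yd.mul yc).add ((yc.add hβ).mul ((yc.add hβ).add yb))).add
    (yb.mul ((hβ.add yb).add ya))).const_mul 6).add ((hb.const_mul 6).mul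
    ((((yc.add hβ).add yb).add (zc.add hb)).add yb))).sub ht
  have lc := ((hb.const_mul 6).mul ((zd.add ((yc.add hβ).add yb)).add (zc.add hb))).abs
  have ld := ((hb.const_mul 6).mul yc).abs
  have hsum := ((la.add lb).add lc).add ld
  -- The off-diagonal limits sum to 84X² and the diagonal limit is 96X²; the margins 87 and 90 give
  -- the contraction factor 29/30.
  have e₁ : |6 * X * X| + |6 * X * (X + X + (X + X + X) + X)| +
      |6 * X * (X + (X + X + X) + (X + X))| + |6 * X * X| < 87 * X ^ 2 := by
    rw [abs_of_pos (by positivity), abs_of_pos (by positivity), abs_of_pos (by positivity)]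
    nlinarith
  have e₂ : 90 * X ^ 2 < 6 * (X * X + (X + X) * (X + X + X) + X * (X + X + X)) +
      6 * X * (X + X + X + (X + X) + X) - 0 := by nlinarith
  obtain ⟨C, hC0, hC⟩ := hres.exists_pos
  rw [IsBigOWith] at hC
  have hbd := (hβ.sub hb).abs.eventually (gt_mem_nhds (show |X - X| < 1 by simp))
  obtain ⟨N, hN⟩ := eventually_atTop.1 ((hsum.eventually (gt_mem_nhds e₁)).and
    ((lz.eventually (lt_mem_nhds e₂)).and (hC.and (hbd.and (eventually_ge_atTop 4)))))
  -- A crude a priori bound suffices for the decay lemma: |β_n - b_n| h < 1 = n h³ ≤ n h.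
  have hv : ∀ n ≥ N, |β n - b n| ≤ 1 * n := by
    intro n hn
    obtain ⟨-, -, -, h4, hn4⟩ := hN n hn
    have hh := cbrtInv_pos (n := n) (by omega)
    have h3 := cbrtInv_pow_three_mul (n := n) (by omega)
    have hh1 := cbrtInv_le_one (n := n) (by omega)
    rw [← sub_mul, abs_mul, abs_of_pos hh] at h4
    have hle : cbrtInv n ^ 3 ≤ cbrtInv n := by
      simpa using pow_le_pow_of_le_one hh.le hh1 (show 1 ≤ 3 by norm_num)
    have : |β n - b n| * cbrtInv n ≤ n * cbrtInv n := by
      have := mul_le_mul_of_nonneg_left hle n.cast_nonneg (α := ℝ)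
      linarith
    rw [one_mul]
    exact le_of_mul_le_mul_right this hh
  have hstep : ∀ n ≥ N, ∀ M, |β (n - 2) - b (n - 2)| ≤ M → |β (n - 1) - b (n - 1)| ≤ M →
      |β (n + 1) - b (n + 1)| ≤ M → |β (n + 2) - b (n + 2)| ≤ M →
      |β n - b n| ≤ 29 / 30 * M + C / (90 * X ^ 2) / (n : ℝ) ^ 2 := by
    intro n hn M ma mb mc md
    obtain ⟨h1, h2, h3, -, hn4⟩ := hN n hn
    have hh := cbrtInv_pos (n := n) (by omega)
    have hh3 := cbrtInv_pow_three_mul (n := n) (by omega)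
    have hM : 0 ≤ M := (abs_nonneg _).trans ma
    have hs := h.scaled_eq hn4
    have hd := freudCubic_sub (β (n - 2) * cbrtInv n) (β (n - 1) * cbrtInv n) (β n * cbrtInv n)
      (β (n + 1) * cbrtInv n) (β (n + 2) * cbrtInv n) (b (n - 2) * cbrtInv n)
      (b (n - 1) * cbrtInv n) (b n * cbrtInv n) (b (n + 1) * cbrtInv n) (b (n + 2) * cbrtInv n)
    rw [Real.norm_of_nonneg (r := cbrtInv n ^ 7) (by positivity), Real.norm_eq_abs] at h3
    set R := freudCubic (b (n - 2) * cbrtInv n) (b (n - 1) * cbrtInv n) (b n * cbrtInv n)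
      (b (n + 1) * cbrtInv n) (b (n + 2) * cbrtInv n) - (1 + (if Odd n then ρ else 0) * cbrtInv n ^ 3
        + 2 * t * cbrtInv n ^ 2 * (b n * cbrtInv n)) with hR
    set ca := 6 * (b n * cbrtInv n) * (β (n - 1) * cbrtInv n) with hca
    set cb := 6 * (b n * cbrtInv n) * (b (n + 1) * cbrtInv n + b n * cbrtInv n +
      (b n * cbrtInv n + b (n - 1) * cbrtInv n + b (n - 2) * cbrtInv n) + β (n - 1) * cbrtInv n)
      with hcb
    set cc := 6 * (b n * cbrtInv n) * (b (n + 2) * cbrtInv n +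
      (β (n + 1) * cbrtInv n + β n * cbrtInv n + β (n - 1) * cbrtInv n) +
      (b (n + 1) * cbrtInv n + b n * cbrtInv n)) with hcc
    set cd := 6 * (b n * cbrtInv n) * (β (n + 1) * cbrtInv n) with hcd
    set cz := 6 * (β (n + 2) * cbrtInv n * (β (n + 1) * cbrtInv n) +
        (β (n + 1) * cbrtInv n + β n * cbrtInv n) *
          (β (n + 1) * cbrtInv n + β n * cbrtInv n + β (n - 1) * cbrtInv n) +
        β (n - 1) * cbrtInv n * (β n * cbrtInv n + β (n - 1) * cbrtInv n + β (n - 2) * cbrtInv n)) +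
      6 * (b n * cbrtInv n) * (β (n + 1) * cbrtInv n + β n * cbrtInv n + β (n - 1) * cbrtInv n +
        (b (n + 1) * cbrtInv n + b n * cbrtInv n) + β (n - 1) * cbrtInv n) -
      2 * t * cbrtInv n ^ 2 with hcz
    -- The difference of the two t-terms is absorbed into the diagonal coefficient `cz`, whose limit
    -- it does not affect.
    have hlin : cz * (β n - b n) * cbrtInv n = -(R + (ca * (β (n - 2) - b (n - 2))
        + cb * (β (n - 1) - b (n - 1)) + cc * (β (n + 1) - b (n + 1))
        + cd * (β (n + 2) - b (n + 2))) * cbrtInv n) := by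
      rw [hs] at hd
      rw [hR, hca, hcb, hcc, hcd, hcz]
      linear_combination -hd
    have hsq : cbrtInv n ^ 6 = 1 / (n : ℝ) ^ 2 := by
      have : (n : ℝ) ≠ 0 := by
        have : 0 < n := by omega
        positivity
      field_simp
      linear_combination ((n : ℝ) * cbrtInv n ^ 3 + 1) * hh3
    have habs : |ca * (β (n - 2) - b (n - 2)) + cb * (β (n - 1) - b (n - 1))
        + cc * (β (n + 1) - b (n + 1)) + cd * (β (n + 2) - b (n + 2))| ≤ 87 * X ^ 2 * M := by
      calc _ ≤ |ca| * |β (n - 2) - b (n - 2)| + |cb| * |β (n - 1) - b (n - 1)|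
          + |cc| * |β (n + 1) - b (n + 1)| + |cd| * |β (n + 2) - b (n + 2)| := by
            simp only [← abs_mul]
            exact (abs_add_le _ _).trans (add_le_add_left ((abs_add_le _ _).trans
              (add_le_add_left (abs_add_le _ _) _)) _)
        _ ≤ |ca| * M + |cb| * M + |cc| * M + |cd| * M := by gcongr
        _ = (|ca| + |cb| + |cc| + |cd|) * M := by ring
        _ ≤ _ := by gcongr
    have hfin : 90 * X ^ 2 * |β n - b n| * cbrtInv n
        ≤ (C * cbrtInv n ^ 6 + 87 * X ^ 2 * M) * cbrtInv n := by
      calc 90 * X ^ 2 * |β n - b n| * cbrtInv n ≤ cz * |β n - b n| * cbrtInv n := by gcongr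
        _ = |cz * (β n - b n) * cbrtInv n| := by
          rw [abs_mul, abs_mul, abs_of_pos hh, abs_of_pos (lt_trans (by positivity) h2)]
        _ ≤ |R| + |(ca * (β (n - 2) - b (n - 2)) + cb * (β (n - 1) - b (n - 1))
            + cc * (β (n + 1) - b (n + 1)) + cd * (β (n + 2) - b (n + 2))) * cbrtInv n| := by
          rw [hlin, abs_neg]
          exact abs_add_le _ _
        _ ≤ C * cbrtInv n ^ 7 + 87 * X ^ 2 * M * cbrtInv n := by
          rw [abs_mul, abs_of_pos hh]
          gcongr
        _ = _ := by ring
    have hfin := le_of_mul_le_mul_right hfin hh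
    rw [hsq] at hfin
    have : |β n - b n| ≤ (C * (1 / (n : ℝ) ^ 2) + 87 * X ^ 2 * M) / (90 * X ^ 2) := by
      rw [le_div_iff₀ (by positivity)]
      linarith
    refine this.trans (le_of_eq ?_)
    field_simp
    ring
  obtain ⟨D, hD⟩ := exists_bound_of_contracting_step (v := fun n => |β n - b n|) (by norm_num)
    (by norm_num : (29 / 30 : ℝ) < 1) (by positivity) zero_le_one hv hstep
  refine IsBigO.of_bound D (hD.mono fun n hn => ?_)
  rw [Real.norm_eq_abs, Real.norm_of_nonneg (by positivity), mul_one_div]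
  exact hn

theorem isFreudSequence_of_isMonicOrthogonal {t lam : ℝ} (hlam : -1 < lam) {P : ℕ → ℝ[X]}
    {β : ℕ → ℝ} (hP : IsMonicOrthogonal (sexticFreudWeight t lam) P)
    (hβ : IsRecurrenceCoeff P β) : IsFreudSequence t (2 * lam + 1) β where
  pos n hn := by
    obtain ⟨m, rfl⟩ := Nat.exists_eq_add_of_lt hn
    simpa using (isOrthogonalFor_of_isMonicOrthogonal hP hβ).coeff_pos m
  eq n hn := by
    obtain ⟨m, rfl⟩ := Nat.exists_eq_add_of_le' hn
    have := (isOrthogonalFor_of_isMonicOrthogonal hP hβ).string_equation (t := t) (lam := lam)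
      (fun r => by rw [momentFunctional_apply]; exact integral_pearsonOp t hlam r) m
    rw [freudCubic]
    push_cast
    exact this

theorem isBigO_sub_expansions {t lam : ℝ} {β : ℕ → ℝ} (h : IsFreudSequence t (2 * lam + 1) β) :
    (fun n : ℕ => β n - if Even n then evenExpansion t lam n else oddExpansion t lam n)
      =O[atTop] fun n : ℕ => 1 / (n : ℝ) ^ 2 := by
  have hk := kappa_pow_three
  have hk0 := kappa_pos
  set E := cbrtExpansion (kappa ^ 2 / 60) (t * kappa / 90)
      (-((2 * lam + 1) * kappa ^ 2 / 90)) (-(4 * t * (2 * lam + 1) * kappa / 135))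
      (-((t ^ 3 - 135 * (7 * lam ^ 2 + 7 * lam + 2)) * kappa ^ 2 / 36450)) with hE
  set O := cbrtExpansion (kappa ^ 2 / 60) (t * kappa / 90)
      ((2 * lam + 1) * kappa ^ 2 / 60) (7 * t * (2 * lam + 1) * kappa / 270)
      (-((2 * t ^ 3 + 135 * (6 * lam ^ 2 + 6 * lam + 1)) * kappa ^ 2 / 72900)) with hO
  have hb : ∀ n : ℕ, (if Even n then evenExpansion t lam n else oddExpansion t lam n) =
      if Even n then E n else O n := fun n => by
    rw [evenExpansion_eq t lam n.cast_nonneg, oddExpansion_eq t lam n.cast_nonneg]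
  simp only [hb]
  refine h.isBigO_sub (X := kappa ^ 2 / 60) (by positivity)
    (by linear_combination ((kappa ^ 3 + 60) / 3600) * hk) ?_ ?_
  · have tE := (hasTruncExpansion_cbrtExpansion (kappa ^ 2 / 60) (t * kappa / 90)
      (-((2 * lam + 1) * kappa ^ 2 / 90)) (-(4 * t * (2 * lam + 1) * kappa / 135))
      (-((t ^ 3 - 135 * (7 * lam ^ 2 + 7 * lam + 2)) * kappa ^ 2 / 36450)) 0).tendsto
    have tO := (hasTruncExpansion_cbrtExpansion (kappa ^ 2 / 60) (t * kappa / 90)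
      ((2 * lam + 1) * kappa ^ 2 / 60) (7 * t * (2 * lam + 1) * kappa / 270)
      (-((2 * t ^ 3 + 135 * (6 * lam ^ 2 + 6 * lam + 1)) * kappa ^ 2 / 72900)) 0).tendsto
    simp only [add_zero, ← hE, ← hO] at tE tO
    simp only [ite_mul]
    exact tE.if' tO
  · obtain ⟨C₁, h₁⟩ := (scaledResidual_even_isBigO t lam hk).bound
    obtain ⟨C₂, h₂⟩ := (scaledResidual_odd_isBigO t lam hk).bound
    rw [← hE, ← hO] at h₁ h₂
    refine IsBigO.of_bound (max C₁ C₂) ?_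
    filter_upwards [h₁, h₂, eventually_ge_atTop 2] with n h₁ h₂ hn
    have c1 : ((n - 1 : ℕ) : ℝ) = n + -1 := by rw [Nat.cast_sub (by omega)]; push_cast; ring
    have c2 : ((n - 2 : ℕ) : ℝ) = n + -2 := by rw [Nat.cast_sub (by omega)]; push_cast; ring
    rcases Nat.even_or_odd n with he | ho
    · have m1 : ¬ Even (n - 1) := by
        obtain ⟨r, hr⟩ := he
        rw [Nat.not_even_iff_odd]
        exact ⟨r - 1, by omega⟩
      have m2 : Even (n - 2) := he.tsub even_two
      have p1 : ¬ Even (n + 1) := by simpa [Nat.even_add_one] using he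
      have p2 : Even (n + 2) := he.add even_two
      have ho : ¬ Odd n := Nat.not_odd_iff_even.2 he
      rw [if_pos he, if_neg m1, if_pos m2, if_neg p1, if_pos p2, if_neg ho]
      refine le_trans (le_of_eq ?_) (h₁.trans
        (mul_le_mul_of_nonneg_right (le_max_left _ _) (norm_nonneg _)))
      rw [scaledResidual, c1, c2, add_zero]
      push_cast
      congr 1
      ring
    · have he : ¬ Even n := Nat.not_even_iff_odd.2 ho
      have m1 : Even (n - 1) := by
        obtain ⟨r, hr⟩ := ho
        exact ⟨r, by omega⟩
      have m2 : ¬ Even (n - 2) := by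
        obtain ⟨r, hr⟩ := ho
        rw [Nat.not_even_iff_odd]
        exact ⟨r - 1, by omega⟩
      have p1 : Even (n + 1) := ho.add_one
      have p2 : ¬ Even (n + 2) := by
        rw [Nat.not_even_iff_odd]
        exact ho.add_even even_two
      rw [if_neg he, if_pos m1, if_neg m2, if_pos p1, if_neg p2, if_pos ho]
      refine le_trans (le_of_eq ?_) (h₂.trans
        (mul_le_mul_of_nonneg_right (le_max_right _ _) (norm_nonneg _)))
      rw [scaledResidual, c1, c2, add_zero]
      push_cast
      congr 1
      ring

theorem theorem4p9 (t lam : ℝ) (hlam : -1 < lam) :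
    (∃ (P : ℕ → ℝ[X]) (β : ℕ → ℝ),
      IsMonicOrthogonal (sexticFreudWeight t lam) P ∧ IsRecurrenceCoeff P β) ∧
    ∀ (P : ℕ → ℝ[X]) (β : ℕ → ℝ),
      IsMonicOrthogonal (sexticFreudWeight t lam) P → IsRecurrenceCoeff P β →
      ((fun n : ℕ => β n - evenExpansion t lam n)
          =O[atTop ⊓ 𝓟 {n : ℕ | Even n}] fun n : ℕ => 1 / (n : ℝ) ^ 2) ∧
      ((fun n : ℕ => β n - oddExpansion t lam n)
          =O[atTop ⊓ 𝓟 {n : ℕ | Odd n}] fun n : ℕ => 1 / (n : ℝ) ^ 2) := by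
  refine ⟨exists_isMonicOrthogonal t hlam, fun P β hP hβ => ?_⟩
  have h := isBigO_sub_expansions (isFreudSequence_of_isMonicOrthogonal hlam hP hβ)
  refine ⟨(h.mono inf_le_left).congr' ?_ EventuallyEq.rfl,
    (h.mono inf_le_left).congr' ?_ EventuallyEq.rfl⟩
  · filter_upwards [mem_inf_of_right (mem_principal_self _)] with n hn
    rw [if_pos hn]
  · filter_upwards [mem_inf_of_right (mem_principal_self _)] with n hn
    rw [if_neg (Nat.not_even_iff_odd.2 hn)]
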